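/- **Setting.** Graphs are undirected multigraphs with finite degrees. Let $\Xi$ be a complete separable metric space (the mark space). A network on a graph $G=(V,E)$ assigns a mark in $\Xi$ to every vertex and, for every edge, a mark to each of its two ends; the space of networks on $G$ has the product topology. Let $\mathcal G_*$ be the space of rooted-isomorphism classes $[\overline G,o]$ of connected rooted networks, where two classes have distance $1/(1+\alpha)$, $\alpha$ being the supremum of the $r>0$ such that some rooted isomorphism of the balls of radius $\lfloor r\rfloor$ around the roots moves every mark by less than $1/r$. Let $\mathcal G_{**}$ be the analogous space of connected networks with an ordered pair of distinguished vertices. A Borel probability measure $\rho$ on $\mathcal G_*$ is *unimodular* if for all Borel $f:\mathcal G_{**}\to[0,\infty]$ $$\int\sum_{x}f(\overline G,o,x)\,d\rho([\overline G,o])=\int\sum_{x}f(\overline G,x,o)\,d\rho([\overline G,o]).$$ Let $G$ be a fixed connected graph that is unimodular, i.e. the left Haar measure $|\cdot|$ of $\mathrm{Aut}(G)$ (with the topology of pointwise convergence) is also right invariant. Let $S\subset V$ contain exactly one vertex of each $\mathrm{Aut}(G)$-orbit, and assume $$c:=\sum_{s\in S}|\mathrm{Stab}(s)|^{-1}<\infty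 .$$ For a graph $G'$ and $x\in V(G')$, $z\in V$, let $\Phi(x,z)$ be the set of rooted isomorphisms $(G',x)\to(G,z)$. If it is non-empty, let $\lambda'_{(G',x;z)}$ be the probability measure on it that is the image of the Haar probability measure of $\mathrm{Stab}(z)$ under $\gamma\mapsto\gamma\circ\phi_0$ (for any $\phi_0\in\Phi(x,z)$); otherwise let $\lambda'_{(G',x;z)}:=0$. Put $\lambda_{(G',x)}:=\sum_{z\in V}\lambda'_{(G',x;z)}$. For $G'$ isomorphic to $G$, let $\tau(G',x)$ be the unique $s\in S$ with $\Phi(x,s)\neq\emptyset$. For a probability measure $\rho$ on $\mathcal G_*$ that is concentrated on classes of networks whose underlying graph is (isomorphic to) $G$, define a measure on networks on $G$ by $$\lambda_\rho(A):=\int\int_{\Phi(o,\tau(G',o))}\mathbf 1_A(\phi\,\overline{G'})\,d\lambda_{(G',o)}(\phi)\,d\rho([\overline{G'},o]).$$ **Theorem (Invariance and Unimodularity).** 1. Let $\nu$ be an $\mathrm{Aut}(G)$-invariant Borel probability measure on networks on $G$. Choose a network $\overline G$ with law $\nu$ and, independently, a root $s\in S$ with probability $c^{-1}|\mathrm{Stab}(s)|^{-1}$.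 Then the law of $[\overline G,s]$ is a unimodular probability measure on $\mathcal G_*$. 2. Conversely, let $\rho$ be a unimodular probability measure on $\mathcal G_*$ that is concentrated on classes of networks whose underlying graph is $G$. Then $\lambda_\rho$ is an $\mathrm{Aut}(G)$-invariant probability measure on networks on $G$. -/

import Mathlib

open MeasureTheory Set
open scoped ENNReal

universe u v

/-- A multigraph with vertex set `V`, multiple edges and loops allowed. `D` is the set of
edge-ends: every undirected edge consists of the two elements `d`, `rev d` of `D`, where `d` is the
end of the edge at its endpoint `src d`, and `rev d` the end at its other endpoint. -/
@[ext] structure Multigraph (V D : Type u) where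
  src : D → V
  rev : D → D
  rev_rev : ∀ d, rev (rev d) = d
  rev_ne : ∀ d, rev d ≠ d

namespace Multigraph

variable {V D V' D' V'' D'' : Type u}

/-- The simple graph joining distinct vertices that are endpoints of a common edge. It has the
same connectedness and the same graph distance as the multigraph. -/
def toSimple (G : Multigraph V D) : SimpleGraph V :=
  SimpleGraph.fromRel fun x y => ∃ d, G.src d = x ∧ G.src (G.rev d) = y

/-- Connected (in particular nonempty). -/
def Connected (G : Multigraph V D) : Prop := G.toSimple.Connected

/-- All degrees are finite. -/
def LocallyFinite (G : Multigraph V D) : Prop := ∀ x, {d | G.src d = x}.Finite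

/-- The subgraph induced by a set of vertices. -/
def induce (G : Multigraph V D) (B : Set V) :
    Multigraph B {d : D // G.src d ∈ B ∧ G.src (G.rev d) ∈ B} where
  src d := ⟨G.src d.1, d.2.1⟩
  rev d := ⟨G.rev d.1, d.2.2, by rw [G.rev_rev]; exact d.2.1⟩
  rev_rev d := Subtype.ext (G.rev_rev d.1)
  rev_ne d h := G.rev_ne d.1 (congrArg Subtype.val h)

/-- Isomorphisms of multigraphs: bijections of the vertices and of the edges (with their ends)
that preserve incidence. -/
@[ext] structure Iso (G : Multigraph V D) (G' : Multigraph V' D') where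
  onV : V ≃ V'
  onD : D ≃ D'
  map_src : ∀ d, onV (G.src d) = G'.src (onD d)
  map_rev : ∀ d, onD (G.rev d) = G'.rev (onD d)

namespace Iso

variable {G : Multigraph V D} {G' : Multigraph V' D'} {G'' : Multigraph V'' D''}

def refl (G : Multigraph V D) : Iso G G := ⟨Equiv.refl V, Equiv.refl D, fun _ => rfl, fun _ => rfl⟩

def symm (φ : Iso G G') : Iso G' G where
  onV := φ.onV.symm
  onD := φ.onD.symm
  map_src d := by rw [Equiv.symm_apply_eq, φ.map_src, Equiv.apply_symm_apply]
  map_rev d := by rw [Equiv.symm_apply_eq, φ.map_rev, Equiv.apply_symm_apply]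

/-- First `φ`, then `ψ`. -/
def trans (φ : Iso G G') (ψ : Iso G' G'') : Iso G G'' where
  onV := φ.onV.trans ψ.onV
  onD := φ.onD.trans ψ.onD
  map_src d := by simp [φ.map_src, ψ.map_src]
  map_rev d := by simp [φ.map_rev, ψ.map_rev]

/-- The topology of pointwise convergence on vertices and on edges, both discrete. -/
instance : TopologicalSpace (Iso G G') :=
  TopologicalSpace.induced (fun φ => ((φ.onV : V → V'), (φ.onD : D → D')))
    (@instTopologicalSpaceProd (V → V') (D → D')
      (@Pi.topologicalSpace V (fun _ => V') fun _ => ⊥)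
      (@Pi.topologicalSpace D (fun _ => D') fun _ => ⊥))

instance : MeasurableSpace (Iso G G') := borel _

instance : BorelSpace (Iso G G') := ⟨rfl⟩

end Iso

/-- The automorphism group, with composition of maps as the product. -/
abbrev Aut (G : Multigraph V D) : Type u := Iso G G

instance (G : Multigraph V D) : Group G.Aut where
  mul φ ψ := ψ.trans φ
  one := Iso.refl G
  inv φ := φ.symm
  mul_assoc _ _ _ := rfl
  one_mul _ := rfl
  mul_one _ := rfl
  inv_mul_cancel φ := Iso.ext (Equiv.self_trans_symm φ.onV) (Equiv.self_trans_symm φ.onD)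

/-- A graph is unimodular if the left Haar measures of its automorphism group are right
invariant. -/
def IsUnimodular (G : Multigraph V D) : Prop :=
  ∀ μ : Measure G.Aut, μ.IsHaarMeasure → μ.IsMulRightInvariant

/-- The set `Φ(x, z)` of rooted isomorphisms from `(G', x)` to `(G, z)`. -/
def rootedIsos (G' : Multigraph V' D') (G : Multigraph V D) (x : V') (z : V) : Set (Iso G' G) :=
  {φ | φ.onV x = z}

/-- The stabilizer of a vertex. -/
def stab (G : Multigraph V D) (x : V) : Set G.Aut := {γ | γ.onV x = x}

/-- `S` contains exactly one vertex of every orbit of the automorphism group. -/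
def IsOrbitSection (G : Multigraph V D) (S : Set V) : Prop :=
  ∀ x, ∃! s, s ∈ S ∧ ∃ γ : G.Aut, γ.onV x = s

/-- The sum of the reciprocals of the Haar measures of the stabilizers of the vertices in `S`. -/
noncomputable def stabWeight (G : Multigraph V D) (μ : Measure G.Aut) (S : Set V) : ℝ≥0∞ :=
  ∑' s : S, (μ (G.stab s))⁻¹

end Multigraph

open Multigraph

/-- The marks of a network: a mark for each vertex, and for each edge a mark at each of its two
ends. With a fixed underlying graph this is the space of (unrooted) networks on that graph. It
carries the product topology and the product σ-algebra, which is the Borel σ-algebra if `V` and `D`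
are countable and `Ξ` is separable. -/
abbrev Marks (V D : Type u) (Ξ : Type v) : Type (max u v) := (V → Ξ) × (D → Ξ)

/-- Transport of a network along an isomorphism of the underlying graphs. -/
def Multigraph.Iso.mapMarks {V D V' D' : Type u} {Ξ : Type v} {G : Multigraph V D}
    {G' : Multigraph V' D'} (φ : Iso G G') (m : Marks V D Ξ) : Marks V' D' Ξ :=
  (fun x => m.1 (φ.onV.symm x), fun d => m.2 (φ.onD.symm d))

/-- A measure on networks on `G` is invariant under all automorphisms of `G`. -/
def Multigraph.IsAutInvariant {V D : Type u} {Ξ : Type v} [MeasurableSpace Ξ] (G : Multigraph V D)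
    (ν : Measure (Marks V D Ξ)) : Prop :=
  ∀ γ : G.Aut, ν.map γ.mapMarks = ν

/-- A connected locally finite network with `k` (ordered) distinguished vertices. -/
structure RootedNetwork (Ξ : Type v) (k : ℕ) : Type (max (u + 1) v) where
  V : Type u
  D : Type u
  graph : Multigraph V D
  connected : graph.Connected
  locallyFinite : graph.LocallyFinite
  marks : Marks V D Ξ
  root : Fin k → V

namespace RootedNetwork

variable {Ξ : Type v} {k l : ℕ}

/-- The same network with other distinguished vertices. -/
def reroot (N : RootedNetwork.{u} Ξ k) (r : Fin l → N.V) : RootedNetwork.{u} Ξ l :=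
  ⟨N.V, N.D, N.graph, N.connected, N.locallyFinite, N.marks, r⟩

/-- Rooted isomorphism: an isomorphism of the underlying graphs that preserves all marks and takes
the distinguished vertices of one to those of the other, in order. -/
instance setoid (Ξ : Type v) (k : ℕ) : Setoid (RootedNetwork.{u} Ξ k) where
  r N N' := ∃ φ : Iso N.graph N'.graph,
    φ.mapMarks N.marks = N'.marks ∧ ∀ i, φ.onV (N.root i) = N'.root i
  iseqv :=
    { refl := fun N => ⟨Iso.refl _, rfl, fun _ => rfl⟩
      symm := by
        rintro N N' ⟨φ, h, hr⟩
        refine ⟨φ.symm, ?_, fun i => ?_⟩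
        · rw [← h]
          simp [Iso.mapMarks, Iso.symm]
        · rw [← hr i]
          exact φ.onV.symm_apply_apply _
      trans := by
        rintro N N' N'' ⟨φ, h, hr⟩ ⟨ψ, h', hr'⟩
        refine ⟨φ.trans ψ, ?_, fun i => ?_⟩
        · rw [← h', ← h]
          rfl
        · rw [← hr' i, ← hr i]
          rfl }

/-- The vertices within graph distance `n` of a distinguished vertex. -/
def ball (N : RootedNetwork.{u} Ξ k) (n : ℕ) : Set N.V :=
  {x | ∃ i, N.graph.toSimple.dist (N.root i) x ≤ n}

theorem root_mem_ball (N : RootedNetwork.{u} Ξ k) (n : ℕ) (i : Fin k) : N.root i ∈ N.ball n :=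
  ⟨i, by simp⟩

/-- There is an isomorphism of the balls of radius `⌊r⌋` around the distinguished vertices that
respects the distinguished vertices and such that corresponding marks have distance less than
`1 / r`. -/
def Close [MetricSpace Ξ] (r : ℝ) (N N' : RootedNetwork.{u} Ξ k) : Prop :=
  ∃ φ : Iso (N.graph.induce (N.ball ⌊r⌋₊)) (N'.graph.induce (N'.ball ⌊r⌋₊)),
    (∀ i, φ.onV ⟨N.root i, N.root_mem_ball _ i⟩ = ⟨N'.root i, N'.root_mem_ball _ i⟩) ∧
    (∀ x, dist (N.marks.1 x.1) (N'.marks.1 (φ.onV x).1) < 1 / r) ∧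
    (∀ d, dist (N.marks.2 d.1) (N'.marks.2 (φ.onD d).1) < 1 / r)

end RootedNetwork

/-- Isomorphism classes of connected locally finite networks with `k` distinguished vertices:
`k = 1` gives the space of rooted networks, `k = 2` the space of networks with an ordered pair of
distinguished vertices. -/
def NetClass (Ξ : Type v) (k : ℕ) : Type (max (u + 1) v) :=
  Quotient (RootedNetwork.setoid.{u, v} Ξ k)

namespace NetClass

variable {Ξ : Type v} {k : ℕ}

/-- The class of a network with distinguished vertices. -/
def mk (N : RootedNetwork.{u} Ξ k) : NetClass.{u} Ξ k := Quotient.mk _ N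

/-- The local distance `1 / (1 + α)`, where `α` is the supremum of those `r > 0` for which the
networks are close at scale `r`. -/
noncomputable def localDist [MetricSpace Ξ] (g g' : NetClass.{u} Ξ k) : ℝ≥0∞ :=
  1 / (1 + ⨆ r ∈ {r : ℝ | 0 < r ∧ ∃ N N' : RootedNetwork.{u} Ξ k,
    mk N = g ∧ mk N' = g' ∧ N.Close r N'}, ENNReal.ofReal r)

/-- The topology of the local distance (generated by its open balls). -/
instance [MetricSpace Ξ] : TopologicalSpace (NetClass.{u} Ξ k) :=
  TopologicalSpace.generateFrom {U | ∃ g, ∃ ε : ℝ≥0∞, U = {g' | localDist g g' < ε}}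

instance [MetricSpace Ξ] : MeasurableSpace (NetClass.{u} Ξ k) := borel _

instance [MetricSpace Ξ] : BorelSpace (NetClass.{u} Ξ k) := ⟨rfl⟩

/-- The total mass `∑ x, f (N, o, x)` sent by the root. -/
noncomputable def massOut (f : NetClass.{u} Ξ 2 → ℝ≥0∞) : NetClass.{u} Ξ 1 → ℝ≥0∞ :=
  Quotient.lift (fun N => ∑' x : N.V, f (mk (N.reroot ![N.root 0, x]))) (by
    rintro N N' ⟨φ, h, hr⟩
    refine Eq.trans ?_ (φ.onV.tsum_eq fun x' => f (mk (N'.reroot ![N'.root 0, x'])))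
    refine tsum_congr fun x => congrArg f (Quotient.sound ⟨φ, h, fun i => ?_⟩)
    fin_cases i
    · exact hr 0
    · rfl)

/-- The total mass `∑ x, f (N, x, o)` received by the root. -/
noncomputable def massIn (f : NetClass.{u} Ξ 2 → ℝ≥0∞) : NetClass.{u} Ξ 1 → ℝ≥0∞ :=
  Quotient.lift (fun N => ∑' x : N.V, f (mk (N.reroot ![x, N.root 0]))) (by
    rintro N N' ⟨φ, h, hr⟩
    refine Eq.trans ?_ (φ.onV.tsum_eq fun x' => f (mk (N'.reroot ![x', N'.root 0])))
    refine tsum_congr fun x => congrArg f (Quotient.sound ⟨φ, h, fun i => ?_⟩)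
    fin_cases i
    · rfl
    · exact hr 0)

/-- Unimodular probability measures on rooted networks: the Mass-Transport Principle holds. -/
def IsUnimodular [MetricSpace Ξ] (ρ : Measure (NetClass.{u} Ξ 1)) : Prop :=
  IsProbabilityMeasure ρ ∧ ∀ f : NetClass.{u} Ξ 2 → ℝ≥0∞, Measurable f →
    ∫⁻ g, massOut f g ∂ρ = ∫⁻ g, massIn f g ∂ρ

/-- The underlying graph of the class is (isomorphic to) `G`. -/
def IsOn {V D : Type u} (G : Multigraph V D) (g : NetClass.{u} Ξ 1) : Prop :=
  ∃ N : RootedNetwork.{u} Ξ 1, mk N = g ∧ Nonempty (Iso N.graph G)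

end NetClass

namespace Multigraph

variable {V D V' D' : Type u} {Ξ : Type v}

/-- The class of the network on `G` with marks `m`, rooted at `x`. -/
def rootAt (G : Multigraph V D) (hconn : G.Connected) (hfin : G.LocallyFinite) (x : V)
    (m : Marks V D Ξ) : NetClass.{u} Ξ 1 :=
  NetClass.mk ⟨V, D, G, hconn, hfin, m, fun _ => x⟩

/-- The law of the random network on `G` with law `ν`, rooted independently at `s ∈ S` with
probability `c⁻¹ |Stab s|⁻¹`, where `c = ∑ s ∈ S, |Stab s|⁻¹`. -/
noncomputable def randomRooting [MetricSpace Ξ] [MeasurableSpace Ξ] (G : Multigraph V D)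
    (hconn : G.Connected) (hfin : G.LocallyFinite) (μ : Measure G.Aut) (S : Set V)
    (ν : Measure (Marks V D Ξ)) : Measure (NetClass.{u} Ξ 1) :=
  Measure.sum fun s : S =>
    ((G.stabWeight μ S)⁻¹ * (μ (G.stab s))⁻¹) • ν.map (G.rootAt hconn hfin (s : V))

/-- The probability measure on the isomorphisms from `G'` to `G` that is concentrated on `Φ(x, z)`
and arises from the Haar probability measure on the stabilizer of `z` (which is the Haar measure
of the automorphism group conditioned on this compact open subgroup) by composition with an
element of `Φ(x, z)`; it is `0` if `Φ(x, z)` is empty. -/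
noncomputable def lamAt (G : Multigraph V D) (μ : Measure G.Aut) (G' : Multigraph V' D') (x : V')
    (z : V) : Measure (Iso G' G) :=
  open Classical in
  if h : (rootedIsos G' G x z).Nonempty then
    (ProbabilityTheory.cond μ (G.stab z)).map fun γ : G.Aut => h.some.trans γ
  else 0

/-- The analogue of Haar measure for the isomorphisms from `G'` to `G`. -/
noncomputable def lam (G : Multigraph V D) (μ : Measure G.Aut) (G' : Multigraph V' D') (x : V') :
    Measure (Iso G' G) :=
  Measure.sum fun z : V => G.lamAt μ G' x z

/-- For a rooted network with underlying graph isomorphic to `G`, the law of its image under a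
random isomorphism from `Φ(o, type o)`, where `type o` is the element `s` of the orbit section `S`
for which `Φ(o, s)` is nonempty. -/
noncomputable def liftKernel [MeasurableSpace Ξ] (G : Multigraph V D) (μ : Measure G.Aut)
    (S : Set V) (N : RootedNetwork.{u} Ξ 1) : Measure (Marks V D Ξ) :=
  open Classical in
  if h : ∃ s ∈ S, (rootedIsos N.graph G (N.root 0) s).Nonempty then
    ((G.lam μ N.graph (N.root 0)).restrict (rootedIsos N.graph G (N.root 0) h.choose)).map
      fun φ => φ.mapMarks N.marks
  else 0

/-- The lift of a measure on rooted network classes to a measure on unrooted networks on `G`: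
`lift ρ A = ∫ (∫_{Φ(o, type o)} 1_A (φ N) dλ_{(N, o)} (φ)) dρ [N, o]`. The inner integral does not
depend on the representative `(N, o)` of the class. -/
noncomputable def lift [MetricSpace Ξ] [MeasurableSpace Ξ] (G : Multigraph V D)
    (μ : Measure G.Aut) (S : Set V) (ρ : Measure (NetClass.{u} Ξ 1)) : Measure (Marks V D Ξ) :=
  ρ.bind fun g => G.liftKernel μ S (Quotient.out g)

end Multigraph

/-! Both halves are double counting against Haar measure `μ` on `Aut(G)`. Left invariance gives `μ
{γ | γ t = x} = |Stab t|` and right invariance gives `μ {γ | γ x = t} = |Stab t|` whenever these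
sets are nonempty. Hence, for every vertex `x`, the sums over `t ∈ S` of `|Stab t|⁻¹ μ {γ | γ t =
x}` and of `|Stab t|⁻¹ μ {γ | γ x = t}` both equal 1.

From random networks on `G` to rooted classes: for invariant `ν`, the expected mass `F x y` is a
diagonally invariant function. Inserting the first sum, rewriting `∫ F(s, γ t) dμ` as `∫ F(γ⁻¹ s, t)
dμ`, and removing the second sum gives the mass-transport principle on `G`,
`tsum_section_mass_transport`. This is unimodularity of the randomly rooted network.

From rooted classes to networks on `G`: let `w_z(N, o)` be the Haar measure of the `γ` with `γ o =
z` and `γ N ∈ A`. Right invariance makes `w_z` a function of the class, and `lift ρ A` is the sum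
over `t ∈ S` of `|Stab t|⁻¹ ∫ w_t dρ`. Let `x` send to `y` the Haar measure of the `γ` with `γ x =
z`, `γ y = s`, `γ N ∈ A`. The root sends `w_z` and receives `w_s`, so `∫ w_z dρ` does not depend on
`z` (`lintegral_classWeight_eq`). By left invariance, replacing `A` by its preimage under `γ`
replaces `w_t` by `w_{γ t}`, so the lift is invariant.

What remains is measurability on the space of classes, which is analysed only on the part coming
from `G`. That part is a countable union of continuous images of the Polish space of marks. Each
image is a `Gδ` set with countably separated points, because isomorphisms of growing balls have
limits; so a function is Borel there as soon as its pullbacks to marks are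
(`measurableSet_inter_range_rootsAt`). -/

namespace Multigraph

/-! ### Graph distance, countability, and limits of partial isomorphisms. -/

variable {V D V' D' : Type u} {G : Multigraph V D} {G' : Multigraph V' D'}

theorem toSimple_adj_iff {x y : V} :
    G.toSimple.Adj x y ↔ x ≠ y ∧ ∃ d, G.src d = x ∧ G.src (G.rev d) = y := by
  simp only [toSimple, SimpleGraph.fromRel_adj]
  refine and_congr_right fun _ => ⟨?_, Or.inl⟩
  rintro (h | ⟨d, h, h'⟩)
  · exact h
  · exact ⟨G.rev d, h', by rw [G.rev_rev, h]⟩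

theorem dist_src_rev_le (hG : G.Connected) (o : V) (d : D) :
    G.toSimple.dist o (G.src (G.rev d)) ≤ G.toSimple.dist o (G.src d) + 1 := by
  by_cases h : G.src d = G.src (G.rev d)
  · rw [← h]; omega
  · have hadj : G.toSimple.Adj (G.src d) (G.src (G.rev d)) := toSimple_adj_iff.2 ⟨h, d, rfl, rfl⟩
    have := SimpleGraph.Connected.dist_triangle hG (u := o) (v := G.src d) (w := G.src (G.rev d))
    rw [SimpleGraph.dist_eq_one_iff_adj.2 hadj] at this
    exact this

theorem exists_dart_of_dist_eq_succ (hG : G.Connected) {o x : V} {n : ℕ}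
    (h : G.toSimple.dist o x = n + 1) :
    ∃ d, G.src (G.rev d) = x ∧ G.toSimple.dist o (G.src d) = n := by
  -- The geodesic runs from `x` to `o`, so its first edge leads to the predecessor of `x` as seen
  -- from `o`.
  obtain ⟨w, hw⟩ := SimpleGraph.Connected.exists_walk_length_eq_dist hG x o
  cases w with
  | nil => simp at h
  | @cons _ y _ hadj p =>
    obtain ⟨-, d, hd, hd'⟩ := toSimple_adj_iff.1 hadj.symm
    refine ⟨d, hd', ?_⟩
    have h1 := SimpleGraph.dist_le p
    have h2 := dist_src_rev_le hG o d
    rw [SimpleGraph.Walk.length_cons, SimpleGraph.dist_comm] at hw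
    rw [SimpleGraph.dist_comm] at h1
    rw [hd', hd] at h2
    rw [hd]
    omega

theorem finite_setOf_dist_le (hG : G.Connected) (hfin : G.LocallyFinite) (o : V) (n : ℕ) :
    {x | G.toSimple.dist o x ≤ n}.Finite := by
  induction n with
  | zero =>
    refine (finite_singleton o).subset fun x hx => ?_
    have := (SimpleGraph.Connected.dist_eq_zero_iff hG).1 (Nat.le_zero.1 hx)
    exact this.symm
  | succ n ih =>
    refine (ih.union (ih.biUnion fun y _ => (hfin y).image fun d => G.src (G.rev d))).subset
      fun x hx => ?_
    rcases Nat.lt_or_ge (G.toSimple.dist o x) (n + 1) with h | h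
    · exact Or.inl (Nat.lt_succ_iff.1 h)
    · obtain ⟨d, hd, hd'⟩ := exists_dart_of_dist_eq_succ hG (le_antisymm hx h)
      refine Or.inr (mem_biUnion (x := G.src d) ?_ ⟨d, rfl, hd⟩)
      exact hd'.le

theorem countable_vertices (hG : G.Connected) (hfin : G.LocallyFinite) : Countable V := by
  obtain ⟨o⟩ : Nonempty V := SimpleGraph.Connected.nonempty hG
  rw [← countable_univ_iff]
  refine (countable_iUnion fun n => (finite_setOf_dist_le hG hfin o n).countable).mono
    fun x _ => mem_iUnion.2 ⟨_, le_refl (G.toSimple.dist o x)⟩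

theorem countable_darts (hG : G.Connected) (hfin : G.LocallyFinite) : Countable D := by
  have := countable_vertices hG hfin
  rw [← countable_univ_iff]
  exact (countable_iUnion fun x => (hfin x).countable).mono fun d _ => mem_iUnion.2 ⟨G.src d, rfl⟩

/-- A partial map that takes darts in the ball of radius `n` to darts does not increase the
distance from the root. -/
theorem dist_map_le (hG : G.Connected) (hG' : G'.Connected) {o : V} {o' : V'} {n : ℕ}
    (R : V → V' → Prop) (hfun : ∀ x y y', R x y → R x y' → y = y') (ho : R o o')
    (hR : ∀ d, G.toSimple.dist o (G.src d) ≤ n → G.toSimple.dist o (G.src (G.rev d)) ≤ n →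
      ∃ e, R (G.src d) (G'.src e) ∧ R (G.src (G.rev d)) (G'.src (G'.rev e)))
    {x : V} {y : V'} (hxy : R x y) (hx : G.toSimple.dist o x ≤ n) :
    G'.toSimple.dist o' y ≤ G.toSimple.dist o x := by
  obtain ⟨k, hk⟩ : ∃ k, k = G.toSimple.dist o x := ⟨_, rfl⟩
  induction k generalizing x y with
  | zero =>
    have : o = x := (SimpleGraph.Connected.dist_eq_zero_iff hG).1 hk.symm
    subst this
    rw [hfun _ _ _ ho hxy]
    simp
  | succ k ih =>
    obtain ⟨d, rfl, hd⟩ := exists_dart_of_dist_eq_succ hG hk.symm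
    obtain ⟨e, he, he'⟩ := hR d (by omega) hx
    have h1 := ih he (by omega) hd.symm
    have h2 := dist_src_rev_le hG' o' e
    rw [hfun _ _ _ hxy he']
    omega

theorem exists_eventually_of_finite {I α : Type*} (U : Ultrafilter I)
    {R : I → α → Prop} {F : Set α} (hF : F.Finite) (h : ∀ᶠ i in U, ∃ y ∈ F, R i y) :
    ∃ y, ∀ᶠ i in U, R i y := by
  obtain ⟨y, -, hy⟩ := (Ultrafilter.eventually_exists_mem_iff hF).1 h
  exact ⟨y, hy⟩

/-- Partial isomorphisms whose values at every vertex stay in a finite set have a limit along any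
ultrafilter. -/
theorem exists_iso_of_ultrafilter {I : Type*} (U : Ultrafilter I)
    (hG : G.LocallyFinite) (hG' : G'.LocallyFinite)
    (R : I → V → V' → Prop) (Q : I → D → D' → Prop)
    (hR : ∀ x, ∃ F : Set V', F.Finite ∧ ∀ᶠ i in U, ∃ y ∈ F, R i x y)
    (hR' : ∀ y, ∃ F : Set V, F.Finite ∧ ∀ᶠ i in U, ∃ x ∈ F, R i x y)
    (hQ : ∀ d, ∀ᶠ i in U, ∃ e, Q i d e) (hQ' : ∀ e, ∀ᶠ i in U, ∃ d, Q i d e)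
    (Rfun : ∀ i x y y', R i x y → R i x y' → y = y')
    (Rinj : ∀ i x x' y, R i x y → R i x' y → x = x')
    (Qfun : ∀ i x y y', Q i x y → Q i x y' → y = y')
    (Qinj : ∀ i x x' y, Q i x y → Q i x' y → x = x')
    (hsrc : ∀ i d e, Q i d e → R i (G.src d) (G'.src e))
    (hrev : ∀ i d e, Q i d e → Q i (G.rev d) (G'.rev e)) :
    ∃ φ : Iso G G', (∀ x, ∀ᶠ i in U, R i x (φ.onV x)) ∧ ∀ d, ∀ᶠ i in U, Q i d (φ.onD d) := by
  have h1 : ∀ x, ∃ y, ∀ᶠ i in U, R i x y := fun x =>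
    let ⟨_, hF, h⟩ := hR x
    exists_eventually_of_finite U hF h
  have h2 : ∀ y, ∃ x, ∀ᶠ i in U, R i x y := fun y =>
    let ⟨_, hF, h⟩ := hR' y
    exists_eventually_of_finite U (R := fun i x => R i x y) hF h
  choose a ha using h1
  choose b hb using h2
  -- No finiteness is assumed for darts: the source of the image is eventually the fixed vertex `a
  -- (G.src d)`, where only finitely many darts start.
  have h3 : ∀ d, ∃ e, ∀ᶠ i in U, Q i d e := fun d =>
    exists_eventually_of_finite U (hG' (a (G.src d))) (by
      filter_upwards [hQ d, ha (G.src d)] with i ⟨e, he⟩ hi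
      exact ⟨e, Rfun i _ _ _ (hsrc i _ _ he) hi, he⟩)
  have h4 : ∀ e, ∃ d, ∀ᶠ i in U, Q i d e := fun e =>
    exists_eventually_of_finite U (R := fun i x => Q i x e) (hG (b (G'.src e))) (by
      filter_upwards [hQ' e, hb (G'.src e)] with i ⟨d, hd⟩ hi
      exact ⟨d, Rinj i _ _ _ (hsrc i _ _ hd) hi, hd⟩)
  choose p hp using h3
  choose q hq using h4
  refine ⟨⟨⟨a, b, fun x => ?_, fun y => ?_⟩, ⟨p, q, fun d => ?_, fun e => ?_⟩, fun d => ?_,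
    fun d => ?_⟩, ha, hp⟩
  · obtain ⟨i, hi, hi'⟩ := ((ha x).and (hb (a x))).exists
    exact Rinj i _ _ _ hi' hi
  · obtain ⟨i, hi, hi'⟩ := ((hb y).and (ha (b y))).exists
    exact Rfun i _ _ _ hi' hi
  · obtain ⟨i, hi, hi'⟩ := ((hp d).and (hq (p d))).exists
    exact Qinj i _ _ _ hi' hi
  · obtain ⟨i, hi, hi'⟩ := ((hq e).and (hp (q e))).exists
    exact Qfun i _ _ _ hi' hi
  · obtain ⟨i, hi, hi'⟩ := ((ha (G.src d)).and (hp d)).exists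
    exact Rfun i _ _ _ hi (hsrc i _ _ hi')
  · obtain ⟨i, hi, hi'⟩ := ((hp (G.rev d)).and (hp d)).exists
    exact Qfun i _ _ _ hi (hrev i _ _ hi')

theorem Iso.dist_map (hG : G.Connected) (hG' : G'.Connected) (φ : Iso G G') (o x : V) :
    G'.toSimple.dist (φ.onV o) (φ.onV x) = G.toSimple.dist o x := by
  refine le_antisymm ?_ ?_
  · refine dist_map_le hG hG' (fun x y => φ.onV x = y) (fun _ _ _ h h' => h.symm.trans h') rfl
      (fun d _ _ => ⟨φ.onD d, φ.map_src d, ?_⟩) rfl le_rfl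
    rw [← φ.map_rev, φ.map_src]
  · refine dist_map_le hG' hG (fun y x => φ.onV x = y)
      (fun _ _ _ h h' => φ.onV.injective (h.trans h'.symm)) rfl
      (fun d _ _ => ⟨φ.onD.symm d, ?_, ?_⟩) rfl le_rfl
    · rw [φ.map_src, Equiv.apply_symm_apply]
    · rw [φ.map_src, φ.map_rev, Equiv.apply_symm_apply]

end Multigraph

/-! ### Topology of isomorphism spaces, compact open stabilizers, and Haar measure. -/

namespace Multigraph

variable {V D V' D' V'' D'' : Type u} {G : Multigraph V D} {G' : Multigraph V' D'}
  {G'' : Multigraph V'' D''}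

namespace Iso

theorem isOpen_setOf_onV_eq (x : V) (y : V') : IsOpen {φ : Iso G G' | φ.onV x = y} := by
  let : TopologicalSpace V' := ⊥
  let : TopologicalSpace D' := ⊥
  have : DiscreteTopology V' := ⟨rfl⟩
  have h : Continuous fun φ : Iso G G' => ((φ.onV : V → V'), (φ.onD : D → D')) :=
    continuous_induced_dom
  exact (isOpen_discrete {y}).preimage ((continuous_apply x).comp (continuous_fst.comp h))

theorem isOpen_setOf_onD_eq (x : D) (y : D') : IsOpen {φ : Iso G G' | φ.onD x = y} := by
  let : TopologicalSpace V' := ⊥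
  let : TopologicalSpace D' := ⊥
  have : DiscreteTopology D' := ⟨rfl⟩
  have h : Continuous fun φ : Iso G G' => ((φ.onV : V → V'), (φ.onD : D → D')) :=
    continuous_induced_dom
  exact (isOpen_discrete {y}).preimage ((continuous_apply x).comp (continuous_snd.comp h))

theorem le_nhds_of_eventually {F : Filter (Iso G G')} {φ : Iso G G'}
    (hV : ∀ x, ∀ᶠ ψ in F, ψ.onV x = φ.onV x) (hD : ∀ d, ∀ᶠ ψ in F, ψ.onD d = φ.onD d) :
    F ≤ nhds φ := by
  let : TopologicalSpace V' := ⊥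
  let : TopologicalSpace D' := ⊥
  have : DiscreteTopology V' := ⟨rfl⟩
  have : DiscreteTopology D' := ⟨rfl⟩
  rw [nhds_induced, ← Filter.tendsto_iff_comap]
  refine Filter.Tendsto.prodMk_nhds (tendsto_pi_nhds.2 fun x => ?_) (tendsto_pi_nhds.2 fun d => ?_)
  · rw [nhds_discrete]
    exact Filter.tendsto_pure.2 (hV x)
  · rw [nhds_discrete]
    exact Filter.tendsto_pure.2 (hD d)

theorem continuous_of_isOpen {X : Type*} [TopologicalSpace X] {f : X → Iso G G'}
    (hV : ∀ x y, IsOpen {a | (f a).onV x = y}) (hD : ∀ d e, IsOpen {a | (f a).onD d = e}) :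
    Continuous f := by
  refine continuous_iff_continuousAt.2 fun a => le_nhds_of_eventually (fun x => ?_) fun d => ?_
  · exact Filter.eventually_map.2 ((hV x ((f a).onV x)).mem_nhds rfl)
  · exact Filter.eventually_map.2 ((hD d ((f a).onD d)).mem_nhds rfl)

theorem continuous_trans_left (φ : Iso G G') :
    Continuous fun ψ : Iso G' G'' => φ.trans ψ :=
  continuous_of_isOpen (fun x y => isOpen_setOf_onV_eq (φ.onV x) y)
    fun d e => isOpen_setOf_onD_eq (φ.onD d) e

theorem continuous_trans_right (ψ : Iso G' G'') :
    Continuous fun φ : Iso G G' => φ.trans ψ := by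
  refine continuous_of_isOpen (fun x y => ?_) fun d e => ?_
  · convert isOpen_setOf_onV_eq (G := G) (G' := G') x (ψ.onV.symm y) using 3
    exact ψ.onV.eq_symm_apply.symm
  · convert isOpen_setOf_onD_eq (G := G) (G' := G') d (ψ.onD.symm e) using 3
    exact ψ.onD.eq_symm_apply.symm

theorem measurableSet_onV_eq (x : V) (y : V') : MeasurableSet {φ : Iso G G' | φ.onV x = y} :=
  (isOpen_setOf_onV_eq x y).measurableSet

theorem measurable_mapMarks {Ξ : Type v} [MeasurableSpace Ξ] [Countable V] [Countable D] :
    Measurable fun p : Marks V D Ξ × Iso G G' => p.2.mapMarks p.1 := by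
  let : MeasurableSpace V := ⊤
  let : MeasurableSpace D := ⊤
  refine Measurable.prodMk (measurable_pi_lambda _ fun y => ?_) (measurable_pi_lambda _ fun e => ?_)
  · have h : Measurable fun φ : Iso G G' => φ.onV.symm y := by
      refine measurable_to_countable' fun x => ?_
      convert measurableSet_onV_eq (G := G) (G' := G') x y using 1
      ext φ
      exact (Equiv.symm_apply_eq _).trans eq_comm
    have h' : Measurable fun p : Marks V D Ξ × V => p.1.1 p.2 :=
      measurable_from_prod_countable_left fun x => (measurable_pi_apply x).comp measurable_fst
    exact h'.comp (measurable_fst.prodMk (h.comp measurable_snd))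
  · have h : Measurable fun φ : Iso G G' => φ.onD.symm e := by
      refine measurable_to_countable' fun x => ?_
      convert (isOpen_setOf_onD_eq (G := G) (G' := G') x e).measurableSet using 1
      ext φ
      exact (Equiv.symm_apply_eq _).trans eq_comm
    have h' : Measurable fun p : Marks V D Ξ × D => p.1.2 p.2 :=
      measurable_from_prod_countable_left fun x => (measurable_pi_apply x).comp measurable_snd
    exact h'.comp (measurable_fst.prodMk (h.comp measurable_snd))

theorem measurable_mapMarks_left {Ξ : Type v} [MeasurableSpace Ξ] (φ : Iso G G') :
    Measurable (φ.mapMarks : Marks V D Ξ → Marks V' D' Ξ) :=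
  Measurable.prodMk
    (measurable_pi_lambda _ fun y => (measurable_pi_apply (φ.onV.symm y)).comp measurable_fst)
    (measurable_pi_lambda _ fun e => (measurable_pi_apply (φ.onD.symm e)).comp measurable_snd)

end Iso

instance : MeasurableMul G.Aut where
  measurable_const_mul φ := (Iso.continuous_trans_right φ).measurable
  measurable_mul_const φ := (Iso.continuous_trans_left φ).measurable

theorem isOpen_stab (x : V) : IsOpen (G.stab x) := Iso.isOpen_setOf_onV_eq x x

/-- Automorphisms fixing `o` preserve distances to `o`, so every vertex has only finitely many
possible images and preimages; ultrafilters on the stabilizer therefore converge. -/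
theorem isCompact_stab (hG : G.Connected) (hfin : G.LocallyFinite) (o : V) :
    IsCompact (G.stab o) := by
  rw [isCompact_iff_ultrafilter_le_nhds']
  intro U hU
  have hball (x : V) : {y | G.toSimple.dist o y ≤ G.toSimple.dist o x}.Finite :=
    finite_setOf_dist_le hG hfin o _
  obtain ⟨φ, hV, hD⟩ := exists_iso_of_ultrafilter U hfin hfin
    (fun (φ : G.Aut) x y => φ.onV x = y) (fun φ d e => φ.onD d = e)
    (fun x => ⟨_, hball x, by
      filter_upwards [hU] with φ hφ
      refine ⟨_, ?_, rfl⟩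
      have := Iso.dist_map hG hG φ o x
      rw [show φ.onV o = o from hφ] at this
      exact this.le⟩)
    (fun x => ⟨_, hball x, by
      filter_upwards [hU] with φ hφ
      refine ⟨φ.onV.symm x, ?_, φ.onV.apply_symm_apply x⟩
      have := Iso.dist_map hG hG φ o (φ.onV.symm x)
      rw [show φ.onV o = o from hφ, φ.onV.apply_symm_apply] at this
      exact this.ge⟩)
    (fun d => Filter.Eventually.of_forall fun φ => ⟨_, rfl⟩)
    (fun d => Filter.Eventually.of_forall fun φ => ⟨_, φ.onD.apply_symm_apply d⟩)
    (fun _ _ _ _ h h' => h.symm.trans h') (fun φ _ _ _ h h' => φ.onV.injective (h.trans h'.symm))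
    (fun _ _ _ _ h h' => h.symm.trans h') (fun φ _ _ _ h h' => φ.onD.injective (h.trans h'.symm))
    (fun φ d _ h => by rw [φ.map_src, h]) (fun φ d _ h => by rw [φ.map_rev, h])
  refine ⟨φ, ?_, Iso.le_nhds_of_eventually hV hD⟩
  obtain ⟨ψ, h, h'⟩ := ((hV o).and hU).exists
  exact h.symm.trans h'

section Haar

variable (μ : Measure G.Aut)

theorem measure_stab_ne_zero [μ.IsHaarMeasure] (x : V) : μ (G.stab x) ≠ 0 :=
  (isOpen_stab x).measure_ne_zero μ ⟨Iso.refl G, rfl⟩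

theorem measure_stab_ne_top (hG : G.Connected) (hfin : G.LocallyFinite) [μ.IsHaarMeasure] (x : V) :
    μ (G.stab x) ≠ ∞ :=
  (isCompact_stab hG hfin x).measure_ne_top

/-- The set is the left coset `γ Stab(x)`. -/
theorem measure_setOf_onV_eq_of_source [μ.IsMulLeftInvariant] (γ : G.Aut) (x : V) :
    μ {α | α.onV x = γ.onV x} = μ (G.stab x) := by
  rw [← measure_preimage_mul μ γ]
  congr 1
  ext α
  exact γ.onV.injective.eq_iff

/-- The same set is the right coset `Stab(γ x) γ`. This is where unimodularity of `G` enters the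
counting. -/
theorem measure_setOf_onV_eq_of_target [μ.IsMulRightInvariant] (γ : G.Aut) (x : V) :
    μ {α | α.onV x = γ.onV x} = μ (G.stab (γ.onV x)) := by
  rw [← measure_preimage_mul_right μ γ]
  rfl

theorem measure_setOf_onV_eq_ne_top (hG : G.Connected) (hfin : G.LocallyFinite)
    [μ.IsHaarMeasure] (x y : V) : μ {α | α.onV x = y} ≠ ∞ := by
  by_cases h : ∃ γ : G.Aut, γ.onV x = y
  · obtain ⟨γ, rfl⟩ := h
    rw [measure_setOf_onV_eq_of_source]
    exact measure_stab_ne_top μ hG hfin x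
  · have : {α : G.Aut | α.onV x = y} = ∅ := eq_empty_of_forall_notMem fun α hα => h ⟨α, hα⟩
    simp [this]

end Haar

end Multigraph

/-! ### Balls of networks, their isomorphisms, and closeness at a given scale. -/

/-- The restriction of an isomorphism to corresponding induced subgraphs. -/
def Multigraph.Iso.induce {V D V' D' : Type u} {G : Multigraph V D} {G' : Multigraph V' D'}
    (φ : Iso G G') (B : Set V) (B' : Set V') (h : ∀ x, x ∈ B ↔ φ.onV x ∈ B') :
    Iso (G.induce B) (G'.induce B') where
  onV := φ.onV.subtypeEquiv h
  onD := φ.onD.subtypeEquiv fun d => by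
    rw [h, h, φ.map_src, φ.map_src, φ.map_rev]
  map_src d := Subtype.ext (φ.map_src d.1)
  map_rev d := Subtype.ext (φ.map_rev d.1)

namespace RootedNetwork

variable {Ξ : Type v} {k : ℕ} {N N' : RootedNetwork.{u} Ξ k}

theorem finite_ball (N : RootedNetwork.{u} Ξ k) (n : ℕ) : (N.ball n).Finite :=
  (finite_iUnion fun i => finite_setOf_dist_le N.connected N.locallyFinite (N.root i) n).subset
    fun _ ⟨i, hi⟩ => mem_iUnion.2 ⟨i, hi⟩

theorem finite_darts_ball (N : RootedNetwork.{u} Ξ k) (n : ℕ) :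
    {d | N.graph.src d ∈ N.ball n ∧ N.graph.src (N.graph.rev d) ∈ N.ball n}.Finite :=
  ((N.finite_ball n).biUnion fun x _ => N.locallyFinite x).subset fun _ hd =>
    mem_biUnion hd.1 rfl

theorem ball_mono (N : RootedNetwork.{u} Ξ k) {n n' : ℕ} (h : n ≤ n') : N.ball n ⊆ N.ball n' :=
  fun _ ⟨i, hi⟩ => ⟨i, hi.trans h⟩

theorem exists_mem_ball [NeZero k] (N : RootedNetwork.{u} Ξ k) (x : N.V) : ∃ n, x ∈ N.ball n :=
  ⟨_, 0, le_rfl⟩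

/-- A geodesic of length at most `n` from root `i` stays in the ball, so the ball isomorphism
carries it to a path that is no longer. -/
theorem dist_ball_iso_le {n : ℕ}
    (φ : Iso (N.graph.induce (N.ball n)) (N'.graph.induce (N'.ball n))) {i : Fin k}
    (hi : φ.onV ⟨N.root i, N.root_mem_ball n i⟩ = ⟨N'.root i, N'.root_mem_ball n i⟩)
    (x : N.ball n) (hx : N.graph.toSimple.dist (N.root i) x ≤ n) :
    N'.graph.toSimple.dist (N'.root i) (φ.onV x) ≤ N.graph.toSimple.dist (N.root i) x := by
  refine dist_map_le N.connected N'.connected (n := n)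
    (fun y z => ∃ h, (φ.onV ⟨y, h⟩).1 = z) ?_ ⟨N.root_mem_ball n i, congrArg Subtype.val hi⟩
    ?_ ⟨x.2, rfl⟩ hx
  · rintro y z z' ⟨h, rfl⟩ ⟨h', rfl⟩
    rfl
  · intro d hd hd'
    refine ⟨(φ.onD ⟨d, ⟨i, hd⟩, ⟨i, hd'⟩⟩).1, ⟨⟨i, hd⟩, ?_⟩, ⟨⟨i, hd'⟩, ?_⟩⟩
    · exact congrArg Subtype.val (φ.map_src ⟨d, ⟨i, hd⟩, ⟨i, hd'⟩⟩)
    · have h1 := φ.map_src ((N.graph.induce (N.ball n)).rev ⟨d, ⟨i, hd⟩, ⟨i, hd'⟩⟩)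
      rw [φ.map_rev] at h1
      exact congrArg Subtype.val h1

/-- Rooted isomorphisms of arbitrarily large balls have a limit that is an isomorphism. -/
theorem exists_iso_of_ball_isos [NeZero k] (R : ℕ → ℕ) (hR : ∀ n, n ≤ R n)
    (φ : ∀ n, Iso (N.graph.induce (N.ball (R n))) (N'.graph.induce (N'.ball (R n))))
    (hroot : ∀ n i, (φ n).onV ⟨N.root i, N.root_mem_ball _ i⟩ = ⟨N'.root i, N'.root_mem_ball _ i⟩) :
    ∃ Φ : Iso N.graph N'.graph, (∀ i, Φ.onV (N.root i) = N'.root i) ∧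
      (∀ x, ∀ᶠ n in Filter.hyperfilter ℕ, ∃ h, ((φ n).onV ⟨x, h⟩).1 = Φ.onV x) ∧
      ∀ d, ∀ᶠ n in Filter.hyperfilter ℕ, ∃ h, ((φ n).onD ⟨d, h⟩).1 = Φ.onD d := by
  have hroot' : ∀ n i, (φ n).symm.onV ⟨N'.root i, N'.root_mem_ball _ i⟩ =
      ⟨N.root i, N.root_mem_ball _ i⟩ := fun n i => by
    rw [← hroot n i]
    exact (φ n).onV.symm_apply_apply _
  have hball : ∀ (N : RootedNetwork.{u} Ξ k) x, ∀ᶠ n in Filter.hyperfilter ℕ,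
      x ∈ N.ball (R n) ∧ N.graph.toSimple.dist (N.root 0) x ≤ R n := fun N x => by
    filter_upwards [Nat.hyperfilter_le_atTop
      (Filter.eventually_ge_atTop (N.graph.toSimple.dist (N.root 0) x))] with n hn
    exact ⟨⟨0, hn.trans (hR n)⟩, hn.trans (hR n)⟩
  obtain ⟨Φ, h1, h2⟩ := exists_iso_of_ultrafilter (Filter.hyperfilter ℕ) N.locallyFinite
    N'.locallyFinite
    (fun n x y => ∃ h, ((φ n).onV ⟨x, h⟩).1 = y) (fun n d e => ∃ h, ((φ n).onD ⟨d, h⟩).1 = e)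
    (fun x => ⟨_, finite_setOf_dist_le N'.connected N'.locallyFinite (N'.root 0)
      (N.graph.toSimple.dist (N.root 0) x), by
        filter_upwards [hball N x] with n hn
        exact ⟨_, dist_ball_iso_le (φ n) (hroot n 0) ⟨x, hn.1⟩ hn.2, hn.1, rfl⟩⟩)
    (fun y => ⟨_, finite_setOf_dist_le N.connected N.locallyFinite (N.root 0)
      (N'.graph.toSimple.dist (N'.root 0) y), by
        filter_upwards [hball N' y] with n hn
        refine ⟨((φ n).symm.onV ⟨y, hn.1⟩).1,
          dist_ball_iso_le (φ n).symm (hroot' n 0) ⟨y, hn.1⟩ hn.2, Subtype.prop _, ?_⟩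
        exact congrArg Subtype.val ((φ n).onV.apply_symm_apply ⟨y, hn.1⟩)⟩)
    (fun d => by
      filter_upwards [hball N (N.graph.src d), hball N (N.graph.src (N.graph.rev d))] with n h h'
      exact ⟨_, ⟨h.1, h'.1⟩, rfl⟩)
    (fun e => by
      filter_upwards [hball N' (N'.graph.src e), hball N' (N'.graph.src (N'.graph.rev e))]
        with n h h'
      refine ⟨((φ n).onD.symm ⟨e, h.1, h'.1⟩).1, ((φ n).onD.symm ⟨e, h.1, h'.1⟩).2, ?_⟩
      exact congrArg Subtype.val ((φ n).onD.apply_symm_apply ⟨e, h.1, h'.1⟩))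
    (by rintro n x y y' ⟨h, rfl⟩ ⟨h', rfl⟩; rfl)
    (by
      rintro n x y z ⟨h, rfl⟩ ⟨h', e⟩
      exact (congrArg Subtype.val ((φ n).onV.injective (Subtype.ext e))).symm)
    (by rintro n x y y' ⟨h, rfl⟩ ⟨h', rfl⟩; rfl)
    (by
      rintro n x y z ⟨h, rfl⟩ ⟨h', e⟩
      exact (congrArg Subtype.val ((φ n).onD.injective (Subtype.ext e))).symm)
    (by
      rintro n d e ⟨h, rfl⟩
      exact ⟨h.1, congrArg Subtype.val ((φ n).map_src ⟨d, h⟩)⟩)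
    (by
      rintro n d e ⟨h, rfl⟩
      exact ⟨_, congrArg Subtype.val ((φ n).map_rev ⟨d, h⟩)⟩)
  refine ⟨Φ, fun i => ?_, h1, h2⟩
  obtain ⟨n, _, hn⟩ := (h1 (N.root i)).exists
  exact hn.symm.trans (congrArg Subtype.val (hroot n i))

theorem mem_ball_iff_of_iso (φ : Iso N.graph N'.graph)
    (hr : ∀ i, φ.onV (N.root i) = N'.root i) (n : ℕ) (x : N.V) :
    x ∈ N.ball n ↔ φ.onV x ∈ N'.ball n := by
  refine exists_congr fun i => ?_
  rw [← hr i, φ.dist_map N.connected N'.connected]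

section Close

variable [MetricSpace Ξ]

theorem Close.refl {r : ℝ} (hr : 0 < r) (N : RootedNetwork.{u} Ξ k) : N.Close r N :=
  ⟨Iso.refl _, fun _ => rfl, fun _ => by simpa [Iso.refl] using hr,
    fun _ => by simpa [Iso.refl] using hr⟩

theorem Close.of_equiv_left {r : ℝ} {M : RootedNetwork.{u} Ξ k} (h : M ≈ N) (hc : N.Close r N') :
    M.Close r N' := by
  obtain ⟨ψ, hm, hr⟩ := h
  obtain ⟨φ, h1, h2, h3⟩ := hc
  refine ⟨(ψ.induce _ _ (mem_ball_iff_of_iso ψ hr _)).trans φ, fun i => ?_, fun x => ?_,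
    fun d => ?_⟩
  · rw [← h1 i]
    exact congrArg φ.onV (Subtype.ext (hr i))
  · have := h2 ⟨ψ.onV x.1, (mem_ball_iff_of_iso ψ hr _ _).1 x.2⟩
    rw [← hm] at this
    simp only [Iso.mapMarks, Equiv.symm_apply_apply] at this
    exact this
  · have := h3 ((ψ.induce _ _ (mem_ball_iff_of_iso ψ hr _)).onD d)
    rw [← hm] at this
    simp only [Iso.mapMarks, Iso.induce, Equiv.subtypeEquiv_apply, Equiv.symm_apply_apply] at this
    exact this

theorem Close.symm {r : ℝ} (hc : N.Close r N') : N'.Close r N := by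
  obtain ⟨φ, h1, h2, h3⟩ := hc
  refine ⟨φ.symm, fun i => ?_, fun x => ?_, fun d => ?_⟩
  · rw [← h1 i]
    exact φ.onV.symm_apply_apply _
  · have := h2 (φ.onV.symm x)
    rw [φ.onV.apply_symm_apply, dist_comm] at this
    exact this
  · have := h3 (φ.onD.symm d)
    rw [φ.onD.apply_symm_apply, dist_comm] at this
    exact this

theorem Close.of_equiv {r : ℝ} {M M' : RootedNetwork.{u} Ξ k} (h : M ≈ N) (h' : M' ≈ N')
    (hc : N.Close r N') : M.Close r M' :=
  ((hc.of_equiv_left h).symm.of_equiv_left h').symm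

end Close

end RootedNetwork

/-! ### The local distance in terms of representatives. -/

namespace NetClass

variable {Ξ : Type v} {k : ℕ}

/-- Closeness does not depend on representatives, so the supremum can be taken over the given pair.
The case `1 < ε` is separate because the distance is always at most 1, with value 1 when no scale is
admissible. -/
theorem localDist_mk_lt_iff [MetricSpace Ξ] (N N' : RootedNetwork.{u} Ξ k) (ε : ℝ≥0∞) :
    localDist (mk N) (mk N') < ε ↔
      1 < ε ∨ ∃ r : ℝ, 0 < r ∧ N.Close r N' ∧ (1 + ENNReal.ofReal r)⁻¹ < ε := by
  have hset : {r : ℝ | 0 < r ∧ ∃ M M' : RootedNetwork.{u} Ξ k,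
      mk M = mk N ∧ mk M' = mk N' ∧ M.Close r M'} = {r | 0 < r ∧ N.Close r N'} := by
    ext r
    refine and_congr_right fun _ => ⟨?_, fun h => ⟨N, N', rfl, rfl, h⟩⟩
    rintro ⟨M, M', h, h', hc⟩
    exact hc.of_equiv (Quotient.exact h.symm) (Quotient.exact h'.symm)
  rw [localDist, hset, one_div, ENNReal.inv_lt_iff_inv_lt]
  constructor
  · intro h
    refine or_iff_not_imp_left.2 fun hε => ?_
    have h1 : 1 ≤ ε⁻¹ := ENNReal.one_le_inv.2 (not_lt.1 hε)
    have h2 : ε⁻¹ - 1 < ⨆ r ∈ {r : ℝ | 0 < r ∧ N.Close r N'}, ENNReal.ofReal r :=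
      (ENNReal.sub_lt_iff_lt_left ENNReal.one_ne_top h1).2 h
    obtain ⟨r, hr⟩ := lt_iSup_iff.1 h2
    obtain ⟨hr', hr⟩ := lt_iSup_iff.1 hr
    refine ⟨r, hr'.1, hr'.2, ?_⟩
    rw [ENNReal.inv_lt_iff_inv_lt]
    exact (ENNReal.sub_lt_iff_lt_left ENNReal.one_ne_top h1).1 hr
  · rintro (h | ⟨r, hr, hc, h⟩)
    · exact (ENNReal.inv_lt_one.2 h).trans_le le_self_add
    · rw [ENNReal.inv_lt_iff_inv_lt] at h
      exact h.trans_le (add_le_add_right (le_iSup₂ (f := fun (r : ℝ)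
        (_ : r ∈ {r : ℝ | 0 < r ∧ N.Close r N'}) => ENNReal.ofReal r) r ⟨hr, hc⟩) 1)

theorem exists_close_of_localDist_lt [MetricSpace Ξ]
    {N N' : RootedNetwork.{u} Ξ k} {n : ℕ}
    (h : localDist (mk N) (mk N') < (1 + (n : ℝ≥0∞))⁻¹) : ∃ r : ℝ, n < r ∧ N.Close r N' := by
  rcases (localDist_mk_lt_iff N N' _).1 h with h | ⟨r, -, hc, h⟩
  · exact absurd h (not_lt.2 (ENNReal.inv_le_one.2 le_self_add))
  · refine ⟨r, ?_, hc⟩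
    rw [ENNReal.inv_lt_inv, ENNReal.add_lt_add_iff_left ENNReal.one_ne_top] at h
    exact ENNReal.natCast_lt_ofReal.1 h

theorem localDist_lt_of_close [MetricSpace Ξ]
    {N N' : RootedNetwork.{u} Ξ k} {n : ℕ} {r : ℝ} (hr : n < r) (hc : N.Close r N') :
    localDist (mk N) (mk N') < (1 + (n : ℝ≥0∞))⁻¹ := by
  refine (localDist_mk_lt_iff N N' _).2 (Or.inr ⟨r, n.cast_nonneg.trans_lt hr, hc, ?_⟩)
  rw [ENNReal.inv_lt_inv, ENNReal.add_lt_add_iff_left ENNReal.one_ne_top]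
  exact ENNReal.natCast_lt_ofReal.2 hr

theorem isOpen_localDist_lt [MetricSpace Ξ] (g : NetClass.{u} Ξ k)
    (ε : ℝ≥0∞) : IsOpen {g' | localDist g g' < ε} :=
  TopologicalSpace.isOpen_generateFrom_of_mem ⟨g, ε, rfl⟩

end NetClass

/-! ### Borel structure of the classes of networks on `G`. -/

namespace Multigraph

variable {V D : Type u} {Ξ : Type v} {k : ℕ} (G : Multigraph V D) (hconn : G.Connected)
  (hfin : G.LocallyFinite)

/-- The network on `G` with marks `m` and distinguished vertices `r`. -/
def network (r : Fin k → V) (m : Marks V D Ξ) : RootedNetwork.{u} Ξ k :=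
  ⟨V, D, G, hconn, hfin, m, r⟩

/-- The class of the network on `G` with marks `m` and distinguished vertices `r`. -/
def rootsAt (r : Fin k → V) (m : Marks V D Ξ) : NetClass.{u} Ξ k :=
  NetClass.mk (G.network hconn hfin r m)

theorem rootsAt_eq_iff {r r' : Fin k → V} {m m' : Marks V D Ξ} :
    G.rootsAt hconn hfin r m = G.rootsAt hconn hfin r' m' ↔
      ∃ γ : G.Aut, γ.mapMarks m = m' ∧ ∀ i, γ.onV (r i) = r' i :=
  ⟨fun h => Quotient.exact h, fun h => Quotient.sound h⟩

theorem exists_rootsAt_eq_mk {N : RootedNetwork.{u} Ξ k} (φ : Iso N.graph G) :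
    G.rootsAt hconn hfin (fun i => φ.onV (N.root i)) (φ.mapMarks N.marks) = NetClass.mk N :=
  (Quotient.sound (⟨φ, rfl, fun _ => rfl⟩ : N ≈ G.network hconn hfin _ _)).symm

section Metric

variable [MetricSpace Ξ]

/-- The ball is finite and the underlying graph is fixed, so one ball isomorphism keeps working
under small changes of the marks: only finitely many strict inequalities are involved. -/
theorem isOpen_setOf_close_network (N : RootedNetwork.{u} Ξ k) (t : ℝ) (r : Fin k → V) :
    IsOpen {m : Marks V D Ξ | N.Close t (G.network hconn hfin r m)} := by
  have hV : Finite (N.ball ⌊t⌋₊) := N.finite_ball _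
  have hD : Finite {d : N.D // N.graph.src d ∈ N.ball ⌊t⌋₊ ∧
    N.graph.src (N.graph.rev d) ∈ N.ball ⌊t⌋₊} := N.finite_darts_ball _
  refine isOpen_iff_mem_nhds.2 fun m ⟨φ, h1, h2, h3⟩ => ?_
  have e1 : ∀ x : N.ball ⌊t⌋₊, ∀ᶠ m' : Marks V D Ξ in nhds m,
      dist (N.marks.1 x.1) (m'.1 (φ.onV x).1) < 1 / t := fun x => by
    refine IsOpen.mem_nhds (isOpen_lt (continuous_const.dist
      ((continuous_apply _).comp continuous_fst)) continuous_const) (h2 x)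
  have e2 : ∀ d : {d : N.D // N.graph.src d ∈ N.ball ⌊t⌋₊ ∧
      N.graph.src (N.graph.rev d) ∈ N.ball ⌊t⌋₊}, ∀ᶠ m' : Marks V D Ξ in nhds m,
      dist (N.marks.2 d.1) (m'.2 (φ.onD d).1) < 1 / t := fun d => by
    refine IsOpen.mem_nhds (isOpen_lt (continuous_const.dist
      ((continuous_apply _).comp continuous_snd)) continuous_const) (h3 d)
  filter_upwards [Filter.eventually_all.2 e1, Filter.eventually_all.2 e2] with m' h h'
  exact ⟨φ, h1, h, h'⟩

theorem continuous_rootsAt (r : Fin k → V) :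
    Continuous (G.rootsAt hconn hfin r : Marks V D Ξ → NetClass.{u} Ξ k) := by
  refine continuous_generateFrom_iff.2 ?_
  rintro _ ⟨g, ε, rfl⟩
  obtain ⟨N, rfl⟩ := Quotient.exists_rep g
  have : G.rootsAt hconn hfin r ⁻¹' {g' | NetClass.localDist (NetClass.mk N) g' < ε} =
      {_m : Marks V D Ξ | 1 < ε} ∪ ⋃ t ∈ {t : ℝ | 0 < t ∧ (1 + ENNReal.ofReal t)⁻¹ < ε},
        {m : Marks V D Ξ | N.Close t (G.network hconn hfin r m)} := by
    ext m
    simp only [mem_preimage, mem_ofPred_eq, mem_union, mem_iUnion, rootsAt,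
      NetClass.localDist_mk_lt_iff, exists_prop]
    refine or_congr_right (exists_congr fun t => ?_)
    tauto
  change IsOpen (G.rootsAt hconn hfin r ⁻¹' {g' | NetClass.localDist (NetClass.mk N) g' < ε})
  rw [this]
  exact isOpen_const.union (isOpen_biUnion fun t _ =>
    G.isOpen_setOf_close_network hconn hfin N t r)

theorem exists_mem_dense_near {s : Set (Marks V D Ξ)} (hs : Dense s) (r : Fin k → V)
    (m : Marks V D Ξ) (n : ℕ) :
    ∃ m' ∈ s, (∀ x ∈ (G.network hconn hfin r m).ball (n + 1),
        dist (m'.1 x) (m.1 x) < 1 / (n + 1 : ℝ)) ∧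
      ∀ d ∈ {d | G.src d ∈ (G.network hconn hfin r m).ball (n + 1) ∧
        G.src (G.rev d) ∈ (G.network hconn hfin r m).ball (n + 1)},
        dist (m'.2 d) (m.2 d) < 1 / (n + 1 : ℝ) := by
  have hpos : (0 : ℝ) < 1 / (n + 1) := by positivity
  have e1 : ∀ x ∈ (G.network hconn hfin r m).ball (n + 1), ∀ᶠ m' : Marks V D Ξ in nhds m,
      dist (m'.1 x) (m.1 x) < 1 / (n + 1 : ℝ) := fun x _ =>
    IsOpen.mem_nhds (isOpen_lt (((continuous_apply _).comp continuous_fst).dist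
      continuous_const) continuous_const) (by simpa using hpos)
  have e2 : ∀ d ∈ {d | G.src d ∈ (G.network hconn hfin r m).ball (n + 1) ∧
        G.src (G.rev d) ∈ (G.network hconn hfin r m).ball (n + 1)},
      ∀ᶠ m' : Marks V D Ξ in nhds m, dist (m'.2 d) (m.2 d) < 1 / (n + 1 : ℝ) := fun d _ =>
    IsOpen.mem_nhds (isOpen_lt (((continuous_apply _).comp continuous_snd).dist
      continuous_const) continuous_const) (by simpa using hpos)
  have f1 := (Filter.eventually_all_finite ((G.network hconn hfin r m).finite_ball (n + 1))).2 e1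
  have f2 := (Filter.eventually_all_finite
    ((G.network hconn hfin r m).finite_darts_ball (n + 1))).2 e2
  obtain ⟨m', h, hm'⟩ := mem_closure_iff_nhds.1 (hs m) _ (f1.and f2)
  exact ⟨m', hm', h⟩

variable [NeZero k]

/-- The classes of networks on `G` with given distinguished vertices form a `Gδ` set. -/
theorem measurableSet_range_rootsAt (r : Fin k → V) :
    MeasurableSet (range (G.rootsAt hconn hfin r : Marks V D Ξ → NetClass.{u} Ξ k)) := by
  have : range (G.rootsAt hconn hfin r : Marks V D Ξ → NetClass.{u} Ξ k) =
      ⋂ n : ℕ, ⋃ m, {g | NetClass.localDist (G.rootsAt hconn hfin r m) g <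
        (1 + (n : ℝ≥0∞))⁻¹} := by
    refine Subset.antisymm ?_ fun g hg => ?_
    · rintro _ ⟨m, rfl⟩
      refine mem_iInter.2 fun n => mem_iUnion.2 ⟨m, ?_⟩
      exact NetClass.localDist_lt_of_close (r := n + 1) (by linarith)
        (RootedNetwork.Close.refl (by positivity) _)
    · obtain ⟨N, rfl⟩ := Quotient.exists_rep g
      have h : ∀ n : ℕ, ∃ (m : Marks V D Ξ) (t : ℝ), n < t ∧
          (G.network hconn hfin r m).Close t N := fun n => by
        obtain ⟨m, hm⟩ := mem_iUnion.1 (mem_iInter.1 hg n)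
        obtain ⟨t, ht, hc⟩ := NetClass.exists_close_of_localDist_lt hm
        exact ⟨m, t, ht, hc⟩
      choose m t ht φ hφ _ using h
      -- The networks with marks `m n` all share the graph and roots of the one with marks `m 0`,
      -- and balls ignore marks, so all `φ n` are ball isomorphisms out of a single network.
      obtain ⟨Φ, hr, -, -⟩ := RootedNetwork.exists_iso_of_ball_isos
        (N := G.network hconn hfin r (m 0)) (N' := N) (fun n => ⌊t n⌋₊)
        (fun n => Nat.le_floor (ht n).le) φ hφ
      refine ⟨Φ.symm.mapMarks N.marks, ?_⟩
      rw [show r = fun i => Φ.symm.onV (N.root i) from funext fun i => ?_]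
      · exact G.exists_rootsAt_eq_mk hconn hfin Φ.symm
      · rw [← hr i]
        exact (Φ.onV.symm_apply_apply _).symm
  rw [this]
  exact MeasurableSet.iInter fun n =>
    (isOpen_iUnion fun m => NetClass.isOpen_localDist_lt _ _).measurableSet

/-- Countably many balls separate the classes: approximating `m` by points of `s` shows that the two
networks are close at every scale, and the ball isomorphisms have a limit that matches the marks
exactly. -/
theorem rootsAt_eq_of_forall_localDist {s : Set (Marks V D Ξ)} (hs : Dense s) (r : Fin k → V)
    (m m' : Marks V D Ξ)
    (h : ∀ m₀ ∈ s, ∀ n : ℕ, NetClass.localDist (G.rootsAt hconn hfin r m₀)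
        (G.rootsAt hconn hfin r m) < (1 + (n : ℝ≥0∞))⁻¹ →
      NetClass.localDist (G.rootsAt hconn hfin r m₀)
        (G.rootsAt hconn hfin r m') < (1 + (n : ℝ≥0∞))⁻¹) :
    G.rootsAt hconn hfin r m = G.rootsAt hconn hfin r m' := by
  have h1 : ∀ n : ℕ, ∃ (m₀ : Marks V D Ξ) (t : ℝ), n < t ∧
      ((∀ x ∈ (G.network hconn hfin r m).ball (n + 1),
        dist (m₀.1 x) (m.1 x) < 1 / (n + 1 : ℝ)) ∧
      ∀ d ∈ {d | G.src d ∈ (G.network hconn hfin r m).ball (n + 1) ∧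
        G.src (G.rev d) ∈ (G.network hconn hfin r m).ball (n + 1)},
        dist (m₀.2 d) (m.2 d) < 1 / (n + 1 : ℝ)) ∧
      (G.network hconn hfin r m₀).Close t (G.network hconn hfin r m') := fun n => by
    obtain ⟨m₀, hm₀, hV, hD⟩ := G.exists_mem_dense_near hconn hfin hs r m n
    have hfl : ⌊(n + 1 : ℝ)⌋₊ = n + 1 := by exact_mod_cast Nat.floor_natCast (R := ℝ) (n + 1)
    -- Scale `n + 1` is used because a distance strictly below `1 / (1 + n)` requires closeness at a
    -- scale strictly above `n`.
    have hc : (G.network hconn hfin r m₀).Close (n + 1 : ℝ) (G.network hconn hfin r m) := by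
      refine ⟨Iso.refl _, fun _ => rfl, fun x => hV x.1 ?_, fun d => hD d.1 ?_⟩
      · exact RootedNetwork.ball_mono _ hfl.le x.2
      · exact ⟨RootedNetwork.ball_mono _ hfl.le d.2.1, RootedNetwork.ball_mono _ hfl.le d.2.2⟩
    obtain ⟨t, ht, hc'⟩ := NetClass.exists_close_of_localDist_lt
      (h m₀ hm₀ n (NetClass.localDist_lt_of_close (by linarith) hc))
    exact ⟨m₀, t, ht, ⟨hV, hD⟩, hc'⟩
  choose m₀ t ht hnear φ hφ hV hD using h1
  obtain ⟨Φ, hr, hΦV, hΦD⟩ := RootedNetwork.exists_iso_of_ball_isos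
    (N := G.network hconn hfin r m) (N' := G.network hconn hfin r m') (fun n => ⌊t n⌋₊)
    (fun n => Nat.le_floor (ht n).le) φ hφ
  have hlim : Filter.Tendsto (fun n : ℕ => 1 / (n + 1 : ℝ) + 1 / n) (Filter.hyperfilter ℕ)
      (nhds 0) := by
    have := tendsto_one_div_add_atTop_nhds_zero_nat (𝕜 := ℝ)
    have h2 := this.add (tendsto_one_div_atTop_nhds_zero_nat (𝕜 := ℝ))
    rw [add_zero] at h2
    exact h2.mono_left Nat.hyperfilter_le_atTop
  have hbound : ∀ n : ℕ, 0 < n → 1 / t n ≤ 1 / (n : ℝ) := fun n hn =>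
    one_div_le_one_div_of_le (Nat.cast_pos.2 hn) (ht n).le
  have hlarge : ∀ x, ∀ᶠ n in Filter.hyperfilter ℕ,
      0 < n ∧ x ∈ (G.network hconn hfin r m).ball (n + 1) := fun x => by
    obtain ⟨n₀, hn₀⟩ := (G.network hconn hfin r m).exists_mem_ball x
    filter_upwards [Nat.hyperfilter_le_atTop (Filter.eventually_ge_atTop (n₀ + 1))] with n hn
    exact ⟨by omega, RootedNetwork.ball_mono _ (by omega) hn₀⟩
  have hmV : ∀ x, m.1 x = m'.1 (Φ.onV x) := fun x => by
    refine dist_le_zero.1 (ge_of_tendsto hlim ?_)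
    filter_upwards [hΦV x, hlarge x] with n ⟨hx, hn⟩ ⟨hpos, hn'⟩
    refine (dist_triangle_left _ _ ((m₀ n).1 x)).trans (add_le_add ((hnear n).1 x hn').le ?_)
    rw [← hn]
    exact (hV n ⟨x, hx⟩).le.trans (hbound n hpos)
  have hmD : ∀ d, m.2 d = m'.2 (Φ.onD d) := fun d => by
    refine dist_le_zero.1 (ge_of_tendsto hlim ?_)
    filter_upwards [hΦD d, hlarge (G.src d), hlarge (G.src (G.rev d))]
      with n ⟨hd, hn⟩ ⟨hpos, hn'⟩ ⟨_, hn''⟩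
    refine (dist_triangle_left _ _ ((m₀ n).2 d)).trans
      (add_le_add ((hnear n).2 d ⟨hn', hn''⟩).le ?_)
    rw [← hn]
    exact (hD n ⟨d, hd⟩).le.trans (hbound n hpos)
  refine (G.rootsAt_eq_iff hconn hfin).2 ⟨Φ, Prod.ext (funext fun y => ?_) (funext fun e => ?_), hr⟩
  · exact (hmV _).trans (congrArg m'.1 (Φ.onV.apply_symm_apply y))
  · exact (hmD _).trans (congrArg m'.2 (Φ.onD.apply_symm_apply e))

variable [CompleteSpace Ξ] [TopologicalSpace.SeparableSpace Ξ] [MeasurableSpace Ξ] [BorelSpace Ξ]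

theorem measurable_rootsAt {k : ℕ} (r : Fin k → V) :
    Measurable (G.rootsAt hconn hfin r : Marks V D Ξ → NetClass.{u} Ξ k) := by
  have := countable_vertices hconn hfin
  have := countable_darts hconn hfin
  exact (G.continuous_rootsAt hconn hfin r).measurable

/-- Inside the range, `A` and its complement are images of Borel subsets of a Polish space, hence
disjoint analytic sets; separation of analytic sets makes them Borel. -/
theorem measurableSet_inter_range_rootsAt (r : Fin k → V) {A : Set (NetClass.{u} Ξ k)}
    (hA : MeasurableSet (G.rootsAt hconn hfin r ⁻¹' A)) :
    MeasurableSet (A ∩ range (G.rootsAt hconn hfin r : Marks V D Ξ → NetClass.{u} Ξ k)) := by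
  have := countable_vertices hconn hfin
  have := countable_darts hconn hfin
  have : MeasurableSpace.CountablySeparated
      (range (G.rootsAt hconn hfin r : Marks V D Ξ → NetClass.{u} Ξ k)) := by
    obtain ⟨s, hs, hd⟩ := TopologicalSpace.exists_countable_dense (Marks V D Ξ)
    refine ⟨⟨⟨(fun p : Marks V D Ξ × ℕ => Subtype.val ⁻¹'
      {g | NetClass.localDist (G.rootsAt hconn hfin r p.1) g < (1 + (p.2 : ℝ≥0∞))⁻¹}) ''
      (s ×ˢ univ), (hs.prod countable_univ).image _, ?_, ?_⟩⟩⟩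
    · rintro _ ⟨p, -, rfl⟩
      exact measurable_subtype_coe (NetClass.isOpen_localDist_lt _ _).measurableSet
    · rintro ⟨_, m, rfl⟩ - ⟨_, m', rfl⟩ - h
      refine Subtype.ext (G.rootsAt_eq_of_forall_localDist hconn hfin hd r m m'
        fun m₀ hm₀ n hn => ?_)
      exact (h _ ⟨(m₀, n), ⟨hm₀, mem_univ _⟩, rfl⟩).1 hn
  exact ((G.measurable_rootsAt hconn hfin r).measurableSet_preimage_iff_inter_range
    (G.measurableSet_range_rootsAt hconn hfin r)).1 hA

/-- The classes of networks with underlying graph `G`. -/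
def rootsRange (Ξ : Type v) (k : ℕ) : Set (NetClass.{u} Ξ k) :=
  ⋃ r : Fin k → V, range (G.rootsAt hconn hfin r : Marks V D Ξ → NetClass.{u} Ξ k)

theorem measurableSet_inter_rootsRange {A : Set (NetClass.{u} Ξ k)}
    (hA : ∀ r, MeasurableSet (G.rootsAt hconn hfin r ⁻¹' A)) :
    MeasurableSet (A ∩ G.rootsRange hconn hfin Ξ k) := by
  have := countable_vertices hconn hfin
  rw [rootsRange, inter_iUnion]
  exact MeasurableSet.iUnion fun r => G.measurableSet_inter_range_rootsAt hconn hfin r (hA r)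

theorem measurableSet_rootsRange : MeasurableSet (G.rootsRange hconn hfin Ξ k) := by
  simpa using G.measurableSet_inter_rootsRange hconn hfin (A := univ) (Ξ := Ξ) (k := k) (by simp)

open Classical in
theorem measurable_piecewise_rootsRange {Y : Type*} [MeasurableSpace Y] (y : Y)
    {h : NetClass.{u} Ξ k → Y} (hh : ∀ r, Measurable (h ∘ G.rootsAt hconn hfin r)) :
    Measurable ((G.rootsRange hconn hfin Ξ k).piecewise h fun _ => y) := by
  intro B hB
  have hR := G.measurableSet_rootsRange hconn hfin (Ξ := Ξ) (k := k)
  rw [piecewise_preimage, Set.ite]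
  exact (G.measurableSet_inter_rootsRange hconn hfin (A := h ⁻¹' B) fun r => hh r hB).union
    ((measurable_const hB).diff hR)

/-- Quantities such as `massOut f` need not be shown Borel on all classes: it suffices to test them
on marks of `G`. -/
theorem aemeasurable_of_rootsAt {Y : Type*} [MeasurableSpace Y] [Nonempty Y]
    {h : NetClass.{u} Ξ k → Y} (hh : ∀ r, Measurable (h ∘ G.rootsAt hconn hfin r))
    {ρ : Measure (NetClass.{u} Ξ k)} (hρ : ∀ᵐ g ∂ρ, g ∈ G.rootsRange hconn hfin Ξ k) :
    AEMeasurable h ρ := by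
  classical
  refine ⟨_, G.measurable_piecewise_rootsRange hconn hfin (Classical.arbitrary Y) hh, ?_⟩
  filter_upwards [hρ] with g hg
  exact (piecewise_eq_of_mem _ _ _ hg).symm

end Metric

end Multigraph

/-! ### Mass transport on `G`, and unimodularity of the randomly rooted network. -/

namespace Multigraph

variable {V D : Type u} {Ξ : Type v} (G : Multigraph V D) (hconn : G.Connected)
  (hfin : G.LocallyFinite) (μ : Measure G.Aut) {S : Set V}

theorem lintegral_onV [Countable V] (H : V → ℝ≥0∞) (x : V) :
    ∫⁻ γ, H (γ.onV x) ∂μ = ∑' y, H y * μ {γ | γ.onV x = y} := by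
  let _ : MeasurableSpace V := ⊤
  have hm : Measurable fun γ : G.Aut => γ.onV x :=
    measurable_to_countable' fun y => Iso.measurableSet_onV_eq x y
  rw [← lintegral_map (measurable_from_top (f := H)) hm, lintegral_countable']
  refine tsum_congr fun y => ?_
  rw [Measure.map_apply hm (MeasurableSet.singleton y)]
  rfl

theorem lintegral_onV_symm [Countable V] (H : V → ℝ≥0∞) (x : V) :
    ∫⁻ γ, H (γ.onV.symm x) ∂μ = ∑' y, H y * μ {γ | γ.onV y = x} := by
  let _ : MeasurableSpace V := ⊤
  have hset (y : V) : (fun γ : G.Aut => γ.onV.symm x) ⁻¹' {y} = {γ | γ.onV y = x} := by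
    ext γ
    exact (Equiv.symm_apply_eq _).trans eq_comm
  have hm : Measurable fun γ : G.Aut => γ.onV.symm x := measurable_to_countable' fun y => by
    rw [hset]
    exact Iso.measurableSet_onV_eq y x
  rw [← lintegral_map (measurable_from_top (f := H)) hm, lintegral_countable']
  refine tsum_congr fun y => ?_
  rw [Measure.map_apply hm (MeasurableSet.singleton y), hset]

variable [μ.IsHaarMeasure]

-- Only the representative `t` of the orbit of `x` contributes, and `{γ | γ t = x}` is a left coset
-- of its stabilizer.
include hconn hfin in
theorem tsum_inv_stab_mul_source (hS : G.IsOrbitSection S) (x : V) :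
    ∑' t : S, (μ (G.stab t))⁻¹ * μ {γ | γ.onV t = x} = 1 := by
  obtain ⟨s, ⟨hs, γ, hγ⟩, huniq⟩ := hS x
  rw [tsum_eq_single ⟨s, hs⟩]
  · have : x = (γ⁻¹ : G.Aut).onV s := (Equiv.eq_symm_apply _).2 hγ
    rw [this, measure_setOf_onV_eq_of_source]
    exact ENNReal.inv_mul_cancel (measure_stab_ne_zero μ s) (measure_stab_ne_top μ hconn hfin s)
  · intro t ht
    have : {γ : G.Aut | γ.onV t = x} = ∅ := eq_empty_of_forall_notMem fun α hα =>
      ht (Subtype.ext (huniq t ⟨t.2, α⁻¹, (Equiv.symm_apply_eq _).2 (Eq.symm hα)⟩))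
    rw [this, measure_empty, mul_zero]

-- As for sources, but `{γ | γ x = t}` is a right coset of `Stab(t)`, so right invariance is needed.
include hconn hfin in
theorem tsum_inv_stab_mul_target [μ.IsMulRightInvariant] (hS : G.IsOrbitSection S) (x : V) :
    ∑' t : S, (μ (G.stab t))⁻¹ * μ {γ | γ.onV x = t} = 1 := by
  obtain ⟨s, ⟨hs, γ, rfl⟩, huniq⟩ := hS x
  rw [tsum_eq_single ⟨_, hs⟩]
  · rw [measure_setOf_onV_eq_of_target]
    exact ENNReal.inv_mul_cancel (measure_stab_ne_zero μ _) (measure_stab_ne_top μ hconn hfin _)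
  · intro t ht
    have : {γ : G.Aut | γ.onV x = t} = ∅ := eq_empty_of_forall_notMem fun α hα =>
      ht (Subtype.ext (huniq t ⟨t.2, α, hα⟩))
    rw [this, measure_empty, mul_zero]

include hconn hfin in
/-- The mass-transport principle on a unimodular graph. -/
theorem tsum_section_mass_transport [μ.IsMulRightInvariant] (hS : G.IsOrbitSection S)
    (F : V → V → ℝ≥0∞) (hF : ∀ (γ : G.Aut) x y, F (γ.onV x) (γ.onV y) = F x y) :
    ∑' s : S, (μ (G.stab s))⁻¹ * ∑' x, F s x = ∑' s : S, (μ (G.stab s))⁻¹ * ∑' x, F x s := by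
  have := countable_vertices hconn hfin
  -- Both sides are one Haar integral: `F(s, γ t) = F(γ⁻¹ s, t)`, sorted by the value of `γ t` on
  -- the left and of `γ⁻¹ s` on the right.
  have key (s t : V) : ∑' x, F s x * μ {γ | γ.onV t = x} = ∑' y, F y t * μ {γ | γ.onV y = s} := by
    rw [← lintegral_onV, ← lintegral_onV_symm G μ (fun y => F y t)]
    refine lintegral_congr fun γ => ?_
    rw [← hF γ (γ.onV.symm s) t, Equiv.apply_symm_apply]
  calc ∑' s : S, (μ (G.stab s))⁻¹ * ∑' x, F s x
      = ∑' s : S, (μ (G.stab s))⁻¹ *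
          ∑' x, F s x * ∑' t : S, (μ (G.stab t))⁻¹ * μ {γ | γ.onV t = x} := by
        simp_rw [G.tsum_inv_stab_mul_source hconn hfin μ hS, mul_one]
    _ = ∑' s : S, ∑' t : S, (μ (G.stab s))⁻¹ * ((μ (G.stab t))⁻¹ *
          ∑' x, F s x * μ {γ | γ.onV t = x}) := by
        refine tsum_congr fun s => ?_
        simp_rw [← ENNReal.tsum_mul_left (a := F s _)]
        rw [ENNReal.tsum_comm, ENNReal.tsum_mul_left]
        congr 1
        refine tsum_congr fun t => ?_
        rw [← ENNReal.tsum_mul_left]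
        exact tsum_congr fun x => mul_left_comm _ _ _
    _ = ∑' t : S, ∑' s : S, (μ (G.stab s))⁻¹ * ((μ (G.stab t))⁻¹ *
          ∑' y, F y t * μ {γ | γ.onV y = s}) := by
        simp_rw [key]
        exact ENNReal.tsum_comm
    _ = ∑' t : S, (μ (G.stab t))⁻¹ *
          ∑' y, F y t * ∑' s : S, (μ (G.stab s))⁻¹ * μ {γ | γ.onV y = s} := by
        refine tsum_congr fun t => ?_
        simp_rw [← ENNReal.tsum_mul_left (a := F _ _)]
        rw [ENNReal.tsum_comm, ← ENNReal.tsum_mul_left]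
        refine tsum_congr fun s => ?_
        rw [mul_left_comm, ← ENNReal.tsum_mul_left]
        congr 1
        exact tsum_congr fun x => mul_left_comm _ _ _
    _ = ∑' s : S, (μ (G.stab s))⁻¹ * ∑' x, F x s := by
        simp_rw [G.tsum_inv_stab_mul_target hconn hfin μ hS, mul_one]

include hconn hfin in
theorem stabWeight_ne_zero (hS : G.IsOrbitSection S) : G.stabWeight μ S ≠ 0 := by
  obtain ⟨o⟩ : Nonempty V := SimpleGraph.Connected.nonempty hconn
  obtain ⟨s, ⟨hs, -⟩, -⟩ := hS o
  intro h
  exact ENNReal.inv_ne_zero.2 (measure_stab_ne_top μ hconn hfin s)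
    (ENNReal.tsum_eq_zero.1 h ⟨s, hs⟩)

theorem massOut_rootsAt (f : NetClass.{u} Ξ 2 → ℝ≥0∞) (r : Fin 1 → V) (m : Marks V D Ξ) :
    NetClass.massOut f (G.rootsAt hconn hfin r m) =
      ∑' x, f (G.rootsAt hconn hfin ![r 0, x] m) := rfl

theorem massIn_rootsAt (f : NetClass.{u} Ξ 2 → ℝ≥0∞) (r : Fin 1 → V) (m : Marks V D Ξ) :
    NetClass.massIn f (G.rootsAt hconn hfin r m) =
      ∑' x, f (G.rootsAt hconn hfin ![x, r 0] m) := rfl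

section Metric

variable [MetricSpace Ξ] [CompleteSpace Ξ] [TopologicalSpace.SeparableSpace Ξ]
  [MeasurableSpace Ξ] [BorelSpace Ξ]

theorem measurable_rootAt (x : V) :
    Measurable (G.rootAt hconn hfin x : Marks V D Ξ → NetClass.{u} Ξ 1) :=
  G.measurable_rootsAt hconn hfin fun _ : Fin 1 => x

theorem lintegral_map_rootsAt {k : ℕ} [NeZero k] {h : NetClass.{u} Ξ k → ℝ≥0∞}
    (hh : ∀ r, Measurable (h ∘ G.rootsAt hconn hfin r)) (r : Fin k → V)
    (ν : Measure (Marks V D Ξ)) :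
    ∫⁻ g, h g ∂(ν.map (G.rootsAt hconn hfin r)) = ∫⁻ m, h (G.rootsAt hconn hfin r m) ∂ν := by
  have hm := G.measurable_rootsAt hconn hfin (Ξ := Ξ) r
  refine lintegral_map' (G.aemeasurable_of_rootsAt hconn hfin hh ?_) hm.aemeasurable
  exact (ae_map_iff (p := fun g => g ∈ G.rootsRange hconn hfin Ξ k) hm.aemeasurable
    (G.measurableSet_rootsRange hconn hfin)).2
    (Filter.Eventually.of_forall fun m => mem_iUnion.2 ⟨r, m, rfl⟩)

theorem isUnimodular_randomRooting [μ.IsMulRightInvariant] (hS : G.IsOrbitSection S)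
    (hc : G.stabWeight μ S < ∞) (ν : Measure (Marks V D Ξ)) [IsProbabilityMeasure ν]
    (hν : G.IsAutInvariant ν) : NetClass.IsUnimodular (G.randomRooting hconn hfin μ S ν) := by
  have := countable_vertices hconn hfin
  refine ⟨⟨?_⟩, fun f hf => ?_⟩
  · rw [randomRooting, Measure.sum_apply _ MeasurableSet.univ]
    simp_rw [Measure.smul_apply, Measure.map_apply (G.measurable_rootAt hconn hfin _)
      MeasurableSet.univ, preimage_univ, measure_univ, smul_eq_mul, mul_one]
    rw [ENNReal.tsum_mul_left]
    exact ENNReal.inv_mul_cancel (G.stabWeight_ne_zero hconn hfin μ hS) hc.ne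
  · have hfm : ∀ r : Fin 2 → V, Measurable fun m : Marks V D Ξ =>
        f (G.rootsAt hconn hfin r m) := fun r => hf.comp (G.measurable_rootsAt hconn hfin r)
    let F : V → V → ℝ≥0∞ := fun x y => ∫⁻ m, f (G.rootsAt hconn hfin ![x, y] m) ∂ν
    -- Replacing `ν` by its image under `γ` moves the marks together with the two vertices, which
    -- leaves the class unchanged.
    have hF : ∀ (γ : G.Aut) x y, F (γ.onV x) (γ.onV y) = F x y := fun γ x y => by
      change ∫⁻ m, f (G.rootsAt hconn hfin ![γ.onV x, γ.onV y] m) ∂ν = _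
      conv_lhs => rw [← hν γ]
      rw [lintegral_map (hfm _) (Iso.measurable_mapMarks_left γ)]
      refine lintegral_congr fun m => congrArg f ?_
      refine ((G.rootsAt_eq_iff hconn hfin).2 ⟨γ, rfl, fun i => ?_⟩).symm
      fin_cases i <;> rfl
    have hout : ∀ s : V, ∫⁻ g, NetClass.massOut f g ∂(ν.map (G.rootAt hconn hfin s)) =
        ∑' x, F s x := fun s => by
      refine (G.lintegral_map_rootsAt hconn hfin (fun r => ?_) _ ν).trans ?_
      · exact Measurable.tsum (L := .unconditional V) fun x => hfm ![r 0, x]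
      · simp_rw [massOut_rootsAt]
        exact lintegral_tsum fun x => (hfm _).aemeasurable
    have hin : ∀ s : V, ∫⁻ g, NetClass.massIn f g ∂(ν.map (G.rootAt hconn hfin s)) =
        ∑' x, F x s := fun s => by
      refine (G.lintegral_map_rootsAt hconn hfin (fun r => ?_) _ ν).trans ?_
      · exact Measurable.tsum (L := .unconditional V) fun x => hfm ![x, r 0]
      · simp_rw [massIn_rootsAt]
        exact lintegral_tsum fun x => (hfm _).aemeasurable
    simp_rw [randomRooting, lintegral_sum_measure, lintegral_smul_measure, hout, hin, smul_eq_mul,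
      mul_assoc, ENNReal.tsum_mul_left]
    rw [G.tsum_section_mass_transport hconn hfin μ hS F hF]

end Metric

end Multigraph

/-! ### Haar weights of rooted networks, and the lift of a unimodular measure. -/

/-- A representative of a class of networks. -/
noncomputable def NetClass.rep {Ξ : Type v} {k : ℕ} (g : NetClass.{u} Ξ k) :
    RootedNetwork.{u} Ξ k :=
  Quotient.out (s := RootedNetwork.setoid.{u, v} Ξ k) g

namespace Multigraph

variable {V D : Type u} {Ξ : Type v} {k : ℕ} (G : Multigraph V D) (hconn : G.Connected)
  (hfin : G.LocallyFinite) (μ : Measure G.Aut) {S : Set V}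

/-- The Haar measure of the set of automorphisms that take the vertices `r` to `p` and the marks `m`
into `A`. -/
noncomputable def rootWeight (p : Fin k → V) (A : Set (Marks V D Ξ)) (r : Fin k → V)
    (m : Marks V D Ξ) : ℝ≥0∞ :=
  μ {γ | (∀ i, γ.onV (r i) = p i) ∧ γ.mapMarks m ∈ A}

/-- The function on classes of networks on `G` that is induced by `rootWeight`. -/
noncomputable def classWeight (p : Fin k → V) (A : Set (Marks V D Ξ)) (g : NetClass.{u} Ξ k) :
    ℝ≥0∞ :=
  ⨆ (r) (m) (_ : G.rootsAt hconn hfin r m = g), G.rootWeight μ p A r m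

/-- Substituting `α γ` for `α` uses right invariance; this makes the weight an isomorphism
invariant. -/
theorem rootWeight_congr [μ.IsMulRightInvariant] (p : Fin k → V) (A : Set (Marks V D Ξ))
    (γ : G.Aut) (r : Fin k → V) (m : Marks V D Ξ) :
    G.rootWeight μ p A (fun i => γ.onV (r i)) (γ.mapMarks m) = G.rootWeight μ p A r m :=
  measure_preimage_mul_right μ γ {α | (∀ i, α.onV (r i) = p i) ∧ α.mapMarks m ∈ A}

/-- Substituting `γ α` for `α` uses left invariance: moving the event is the same as moving the
target vertices. -/
theorem rootWeight_preimage [μ.IsMulLeftInvariant] (p : Fin k → V) (A : Set (Marks V D Ξ))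
    (γ : G.Aut) (r : Fin k → V) (m : Marks V D Ξ) :
    G.rootWeight μ p (γ.mapMarks ⁻¹' A) r m = G.rootWeight μ (fun i => γ.onV (p i)) A r m := by
  refine Eq.trans ?_ (measure_preimage_mul μ γ _)
  refine congrArg μ (Set.ext fun α => ?_)
  change ((∀ i, α.onV (r i) = p i) ∧ γ.mapMarks (α.mapMarks m) ∈ A) ↔
    (∀ i, γ.onV (α.onV (r i)) = γ.onV (p i)) ∧ γ.mapMarks (α.mapMarks m) ∈ A
  simp_rw [γ.onV.injective.eq_iff]

/-- The supremum runs over one `Aut(G)`-orbit of pairs `(r, m)`, on which the weight is constant. -/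
theorem classWeight_rootsAt [μ.IsMulRightInvariant] (p : Fin k → V) (A : Set (Marks V D Ξ))
    (r : Fin k → V) (m : Marks V D Ξ) :
    G.classWeight hconn hfin μ p A (G.rootsAt hconn hfin r m) = G.rootWeight μ p A r m := by
  refine le_antisymm (iSup_le fun r' => iSup_le fun m' => iSup_le fun h => ?_)
    (le_iSup_of_le r (le_iSup_of_le m (le_iSup_of_le rfl le_rfl)))
  obtain ⟨γ, rfl, hr⟩ := (G.rootsAt_eq_iff hconn hfin).1 h
  rw [← funext hr, rootWeight_congr]

theorem classWeight_of_notMem (p : Fin k → V) (A : Set (Marks V D Ξ)) {g : NetClass.{u} Ξ k}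
    (hg : g ∉ G.rootsRange hconn hfin Ξ k) : G.classWeight hconn hfin μ p A g = 0 := by
  simp only [classWeight, ENNReal.iSup_eq_zero]
  rintro r m rfl
  exact absurd (mem_iUnion.2 ⟨r, mem_range_self m⟩) hg

theorem measurable_rootWeight [MeasurableSpace Ξ] [NeZero k] [μ.IsHaarMeasure]
    (hconn : G.Connected) (hfin : G.LocallyFinite) (p : Fin k → V) {A : Set (Marks V D Ξ)}
    (hA : MeasurableSet A) (r : Fin k → V) : Measurable (G.rootWeight μ p A r) := by
  have := countable_vertices hconn hfin
  have := countable_darts hconn hfin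
  have hC : MeasurableSet {γ : G.Aut | ∀ i, γ.onV (r i) = p i} := by
    convert MeasurableSet.iInter fun i => Iso.measurableSet_onV_eq (G := G) (G' := G) (r i) (p i)
    ext γ
    simp
  -- Haar measure is cut down to the relevant automorphisms, which lie in a set of finite measure
  -- determined by the image of root 0; measurability of sections then applies.
  have : IsFiniteMeasure (μ.restrict {γ : G.Aut | ∀ i, γ.onV (r i) = p i}) := by
    refine isFiniteMeasure_restrict.2 (measure_ne_top_of_subset (fun γ hγ => hγ 0)
      (measure_setOf_onV_eq_ne_top μ hconn hfin (r 0) (p 0)))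
  have h := measurable_measure_prodMk_left
    (ν := μ.restrict {γ : G.Aut | ∀ i, γ.onV (r i) = p i})
    (Iso.measurable_mapMarks (G := G) (G' := G) (Ξ := Ξ) hA)
  convert h using 2 with m
  rw [Measure.restrict_apply (measurable_prodMk_left (Iso.measurable_mapMarks hA)), inter_comm]
  rfl

/-- Each `γ` maps exactly one `y` to `s`, so summing over `y` drops the second constraint. -/
theorem tsum_rootWeight_out [MeasurableSpace Ξ] [Countable V] [Countable D] (z s : V)
    {A : Set (Marks V D Ξ)} (hA : MeasurableSet A) (x : V) (m : Marks V D Ξ) :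
    ∑' y, G.rootWeight μ ![z, s] A ![x, y] m = G.rootWeight μ (fun _ : Fin 1 => z) A ![x] m := by
  have hm : MeasurableSet {γ : G.Aut | γ.mapMarks m ∈ A} :=
    (Iso.measurable_mapMarks.comp (measurable_prodMk_left (x := m))) hA
  simp only [rootWeight, Fin.forall_fin_two, Fin.forall_fin_one, Matrix.cons_val_zero,
    Matrix.cons_val_one]
  rw [← measure_iUnion]
  · congr 1
    ext γ
    simp only [mem_iUnion, mem_ofPred_eq]
    exact ⟨fun ⟨_, h⟩ => ⟨h.1.1, h.2⟩, fun h =>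
      ⟨γ.onV.symm s, ⟨h.1, γ.onV.apply_symm_apply s⟩, h.2⟩⟩
  · intro y y' hy
    refine disjoint_left.2 fun γ h h' => hy (γ.onV.injective (h.1.2.trans h'.1.2.symm))
  · exact fun y => (((Iso.measurableSet_onV_eq x z).inter (Iso.measurableSet_onV_eq y s)).inter hm)

theorem tsum_rootWeight_in [MeasurableSpace Ξ] [Countable V] [Countable D] (z s : V)
    {A : Set (Marks V D Ξ)} (hA : MeasurableSet A) (x : V) (m : Marks V D Ξ) :
    ∑' y, G.rootWeight μ ![z, s] A ![y, x] m = G.rootWeight μ (fun _ : Fin 1 => s) A ![x] m := by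
  rw [← tsum_rootWeight_out G μ s z hA]
  refine tsum_congr fun y => congrArg μ (Set.ext fun γ => and_congr_left fun _ => ?_)
  simp only [Fin.forall_fin_two, Matrix.cons_val_zero, Matrix.cons_val_one]
  exact and_comm

theorem measurableSet_rootedIsos {V' D' : Type u} {G' : Multigraph V' D'} (x : V') (z : V) :
    MeasurableSet (rootedIsos G' G x z) :=
  Iso.measurableSet_onV_eq x z

theorem lamAt_apply_of_ne {V' D' : Type u} {G' : Multigraph V' D'} {x : V'} {z s : V}
    (hzs : z ≠ s) {B : Set (Iso G' G)} (hB : MeasurableSet B) :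
    G.lamAt μ G' x z (B ∩ rootedIsos G' G x s) = 0 := by
  rw [lamAt]
  split_ifs with h
  · rw [Measure.map_apply (Iso.continuous_trans_left _).measurable
      (hB.inter (G.measurableSet_rootedIsos x s)),
      ProbabilityTheory.cond_apply (isOpen_stab z).measurableSet]
    have : G.stab z ∩ (fun γ : G.Aut => h.some.trans γ) ⁻¹' (B ∩ rootedIsos G' G x s) = ∅ := by
      refine eq_empty_of_forall_notMem fun γ hγ => hzs ?_
      have h1 : γ.onV (h.some.onV x) = s := hγ.2.2
      rw [show h.some.onV x = z from h.some_mem] at h1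
      exact (show γ.onV z = z from hγ.1).symm.trans h1
    rw [this, measure_empty, mul_zero]
  · rfl

theorem lamAt_apply {V' D' : Type u} {G' : Multigraph V' D'} {x : V'} {s : V}
    (h : (rootedIsos G' G x s).Nonempty) {B : Set (Iso G' G)} (hB : MeasurableSet B) :
    ∃ φ ∈ rootedIsos G' G x s, G.lamAt μ G' x s (B ∩ rootedIsos G' G x s) =
      (μ (G.stab s))⁻¹ * μ {γ | γ.onV s = s ∧ φ.trans γ ∈ B} := by
  refine ⟨h.some, h.some_mem, ?_⟩
  rw [lamAt, dif_pos h, Measure.map_apply (Iso.continuous_trans_left _).measurable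
    (hB.inter (G.measurableSet_rootedIsos x s)),
    ProbabilityTheory.cond_apply (isOpen_stab s).measurableSet]
  congr 2
  ext γ
  have h1 : h.some.onV x = s := h.some_mem
  refine ⟨fun hγ => ⟨hγ.1, hγ.2.1⟩, fun hγ => ⟨hγ.1, hγ.2, ?_⟩⟩
  change γ.onV (h.some.onV x) = s
  rw [h1]
  exact hγ.1

/-- Identifying `N` with a network on `G` through `φ` turns `λ'` into normalized Haar measure on a
coset. Summing over all of `S` avoids naming the type of the root, since every other `t` has weight
zero. -/
theorem liftKernel_apply [MeasurableSpace Ξ] [μ.IsMulRightInvariant] (hS : G.IsOrbitSection S)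
    (N : RootedNetwork.{u} Ξ 1) (φ : Iso N.graph G) {A : Set (Marks V D Ξ)}
    (hA : MeasurableSet A) :
    G.liftKernel μ S N A = ∑' t : S, (μ (G.stab t))⁻¹ *
      G.rootWeight μ (fun _ : Fin 1 => (t : V)) A (fun i => φ.onV (N.root i))
        (φ.mapMarks N.marks) := by
  have := countable_vertices N.connected N.locallyFinite
  have := countable_darts N.connected N.locallyFinite
  have hex : ∃ s ∈ S, (rootedIsos N.graph G (N.root 0) s).Nonempty := by
    obtain ⟨s, ⟨hs, γ, hγ⟩, -⟩ := hS (φ.onV (N.root 0))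
    exact ⟨s, hs, φ.trans γ, hγ⟩
  rw [liftKernel, dif_pos hex]
  obtain ⟨hs, hne⟩ := hex.choose_spec
  -- Only membership in `S` and nonemptiness of `Φ(o, s)` matter for the chosen type.
  generalize hex.choose = s at hs hne
  have hmeas : Measurable fun ψ : Iso N.graph G => ψ.mapMarks N.marks :=
    Iso.measurable_mapMarks.comp (measurable_prodMk_left (x := N.marks))
  rw [Measure.map_apply hmeas hA, Measure.restrict_apply (hmeas hA), lam,
    Measure.sum_apply _ ((hmeas hA).inter (G.measurableSet_rootedIsos _ s)),
    tsum_eq_single s fun z hz => G.lamAt_apply_of_ne μ hz (hmeas hA)]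
  obtain ⟨φ₀, hφ₀, heq⟩ := G.lamAt_apply μ hne (hmeas hA)
  have hroot : (φ.symm.trans φ₀).onV (φ.onV (N.root 0)) = s :=
    (congrArg φ₀.onV (φ.onV.symm_apply_apply _)).trans hφ₀
  rw [heq, tsum_eq_single ⟨s, hs⟩]
  · congr 1
    rw [← rootWeight_congr G μ _ A (φ.symm.trans φ₀ : G.Aut)]
    refine congrArg μ (Set.ext fun γ => ?_)
    have h1 : (φ.symm.trans φ₀).mapMarks (φ.mapMarks N.marks) = φ₀.mapMarks N.marks := by
      simp [Iso.mapMarks, Iso.trans, Iso.symm]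
    simp only [mem_ofPred_eq, Fin.forall_fin_one, h1, hroot]
    rfl
  · intro t ht
    have : {γ : G.Aut | (∀ i : Fin 1, γ.onV (φ.onV (N.root i)) = (t : V)) ∧
        γ.mapMarks (φ.mapMarks N.marks) ∈ A} = ∅ := by
      refine eq_empty_of_forall_notMem fun γ hγ => ht (Subtype.ext ?_)
      exact (hS (φ.onV (N.root 0))).unique ⟨t.2, γ, hγ.1 0⟩ ⟨hs, φ.symm.trans φ₀, hroot⟩
    rw [rootWeight, this, measure_empty, mul_zero]

theorem liftKernel_rep_apply [MeasurableSpace Ξ] [μ.IsMulRightInvariant]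
    (hS : G.IsOrbitSection S) (r : Fin 1 → V) (m : Marks V D Ξ) {A : Set (Marks V D Ξ)}
    (hA : MeasurableSet A) :
    G.liftKernel μ S (G.rootsAt hconn hfin r m).rep A =
      ∑' t : S, (μ (G.stab t))⁻¹ * G.rootWeight μ (fun _ : Fin 1 => (t : V)) A r m := by
  obtain ⟨φ, hm, hr⟩ : ∃ φ : Iso (G.rootsAt hconn hfin r m).rep.graph G,
      φ.mapMarks (G.rootsAt hconn hfin r m).rep.marks = m ∧
      ∀ i, φ.onV ((G.rootsAt hconn hfin r m).rep.root i) = r i :=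
    Quotient.mk_out (G.network hconn hfin r m)
  rw [G.liftKernel_apply μ hS _ φ hA, hm, funext hr]

theorem isOn_iff_mem_rootsRange {g : NetClass.{u} Ξ 1} :
    NetClass.IsOn G g ↔ g ∈ G.rootsRange hconn hfin Ξ 1 := by
  constructor
  · rintro ⟨N, rfl, ⟨φ⟩⟩
    exact mem_iUnion.2 ⟨_, _, G.exists_rootsAt_eq_mk hconn hfin φ⟩
  · intro h
    obtain ⟨r, m, rfl⟩ := mem_iUnion.1 h
    exact ⟨_, rfl, ⟨Iso.refl G⟩⟩

section Metric

theorem lift_eq_bind [MetricSpace Ξ] [MeasurableSpace Ξ] (ρ : Measure (NetClass.{u} Ξ 1)) :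
    G.lift μ S ρ = ρ.bind fun g => G.liftKernel μ S g.rep := rfl

variable [MetricSpace Ξ] [CompleteSpace Ξ] [TopologicalSpace.SeparableSpace Ξ]
  [MeasurableSpace Ξ] [BorelSpace Ξ] [μ.IsHaarMeasure] [μ.IsMulRightInvariant]

/-- The mass-transport principle needs Borel functions on the whole space; the weight qualifies
because it vanishes off the Borel set of classes on `G`. -/
theorem measurable_classWeight [NeZero k] (p : Fin k → V) {A : Set (Marks V D Ξ)}
    (hA : MeasurableSet A) : Measurable (G.classWeight hconn hfin μ p A) := by
  classical
  have h := G.measurable_piecewise_rootsRange hconn hfin (0 : ℝ≥0∞)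
    (h := G.classWeight hconn hfin μ p A) fun r => by
      convert G.measurable_rootWeight μ hconn hfin p hA r using 1
      exact funext fun m => G.classWeight_rootsAt hconn hfin μ p A r m
  convert h using 1
  ext g
  by_cases hg : g ∈ G.rootsRange hconn hfin Ξ k
  · rw [piecewise_eq_of_mem _ _ _ hg]
  · rw [piecewise_eq_of_notMem _ _ _ hg, G.classWeight_of_notMem hconn hfin μ p A hg]

/-- Mass transport for the two-point weight with targets `![z, s]`: the root sends the one-point
weight of `z` and receives that of `s`. -/
theorem lintegral_classWeight_eq {ρ : Measure (NetClass.{u} Ξ 1)} (hρ : NetClass.IsUnimodular ρ)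
    (hon : ∀ᵐ g ∂ρ, g ∈ G.rootsRange hconn hfin Ξ 1) (z s : V) {A : Set (Marks V D Ξ)}
    (hA : MeasurableSet A) :
    ∫⁻ g, G.classWeight hconn hfin μ (fun _ : Fin 1 => z) A g ∂ρ =
      ∫⁻ g, G.classWeight hconn hfin μ (fun _ : Fin 1 => s) A g ∂ρ := by
  have := countable_vertices hconn hfin
  have := countable_darts hconn hfin
  have h1 (r : Fin 1 → V) : r = ![r 0] := by
    ext i
    fin_cases i
    rfl
  have h := hρ.2 _ (G.measurable_classWeight hconn hfin μ ![z, s] hA)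
  refine (lintegral_congr_ae ?_).trans (h.trans (lintegral_congr_ae ?_))
  · filter_upwards [hon] with g hg
    obtain ⟨r, m, rfl⟩ := mem_iUnion.1 hg
    simp_rw [massOut_rootsAt, classWeight_rootsAt, tsum_rootWeight_out G μ z s hA]
    rw [← h1]
  · filter_upwards [hon] with g hg
    obtain ⟨r, m, rfl⟩ := mem_iUnion.1 hg
    simp_rw [massIn_rootsAt, classWeight_rootsAt, tsum_rootWeight_in G μ z s hA]
    rw [← h1]

theorem aemeasurable_liftKernel_rep (hS : G.IsOrbitSection S) {ρ : Measure (NetClass.{u} Ξ 1)}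
    (hon : ∀ᵐ g ∂ρ, g ∈ G.rootsRange hconn hfin Ξ 1) :
    AEMeasurable (fun g => G.liftKernel μ S g.rep) ρ := by
  have := countable_vertices hconn hfin
  refine G.aemeasurable_of_rootsAt hconn hfin (fun r => ?_) hon
  refine Measure.measurable_of_measurable_coe _ fun A hA => ?_
  simp_rw [Function.comp_apply, G.liftKernel_rep_apply hconn hfin μ hS r _ hA]
  exact Measurable.tsum (L := .unconditional S) fun t =>
    (G.measurable_rootWeight μ hconn hfin _ hA r).const_mul _

theorem lift_apply (hS : G.IsOrbitSection S) {ρ : Measure (NetClass.{u} Ξ 1)}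
    (hon : ∀ᵐ g ∂ρ, g ∈ G.rootsRange hconn hfin Ξ 1) {A : Set (Marks V D Ξ)}
    (hA : MeasurableSet A) :
    G.lift μ S ρ A = ∑' t : S, (μ (G.stab t))⁻¹ *
      ∫⁻ g, G.classWeight hconn hfin μ (fun _ : Fin 1 => (t : V)) A g ∂ρ := by
  have := countable_vertices hconn hfin
  have hm (t : V) := G.measurable_classWeight hconn hfin μ (fun _ : Fin 1 => t) hA
  rw [lift_eq_bind, Measure.bind_apply hA (G.aemeasurable_liftKernel_rep hconn hfin μ hS hon)]
  simp_rw [← lintegral_const_mul _ (hm _)]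
  rw [← lintegral_tsum fun t => ((hm _).const_mul _).aemeasurable]
  refine lintegral_congr_ae ?_
  filter_upwards [hon] with g hg
  obtain ⟨r, m, rfl⟩ := mem_iUnion.1 hg
  simp_rw [G.liftKernel_rep_apply hconn hfin μ hS r m hA, classWeight_rootsAt]

theorem isAutInvariant_lift (hS : G.IsOrbitSection S) {ρ : Measure (NetClass.{u} Ξ 1)}
    (hρ : NetClass.IsUnimodular ρ) (hon : ∀ᵐ g ∂ρ, g ∈ G.rootsRange hconn hfin Ξ 1) :
    G.IsAutInvariant (G.lift μ S ρ) := by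
  intro γ
  refine Measure.ext fun A hA => ?_
  have hγ := Iso.measurable_mapMarks_left (Ξ := Ξ) γ
  rw [Measure.map_apply hγ hA, G.lift_apply hconn hfin μ hS hon (hγ hA),
    G.lift_apply hconn hfin μ hS hon hA]
  refine tsum_congr fun t => congrArg _ ?_
  -- The target `t` is traded for `γ t`, which left invariance then absorbs into the preimage of `A`
  -- under `γ`.
  rw [← G.lintegral_classWeight_eq hconn hfin μ hρ hon (γ.onV t) t hA]
  simp_rw [classWeight, rootWeight_preimage]

theorem isProbabilityMeasure_lift (hS : G.IsOrbitSection S) {ρ : Measure (NetClass.{u} Ξ 1)}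
    [IsProbabilityMeasure ρ] (hon : ∀ᵐ g ∂ρ, g ∈ G.rootsRange hconn hfin Ξ 1) :
    IsProbabilityMeasure (G.lift μ S ρ) := by
  refine ⟨?_⟩
  rw [lift_eq_bind, Measure.bind_apply MeasurableSet.univ
    (G.aemeasurable_liftKernel_rep hconn hfin μ hS hon), ← measure_univ (μ := ρ), ← lintegral_one]
  refine lintegral_congr_ae ?_
  filter_upwards [hon] with g hg
  obtain ⟨r, m, rfl⟩ := mem_iUnion.1 hg
  rw [G.liftKernel_rep_apply hconn hfin μ hS r m MeasurableSet.univ]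
  -- For the full event, the kernel mass is the right-coset identity at the vertex `r 0`.
  simpa [rootWeight] using G.tsum_inv_stab_mul_target hconn hfin μ hS (r 0)

end Metric

end Multigraph

theorem theoremt {V D : Type u} {Ξ : Type v} [MetricSpace Ξ] [CompleteSpace Ξ]
    [TopologicalSpace.SeparableSpace Ξ] [MeasurableSpace Ξ] [BorelSpace Ξ]
    (G : Multigraph V D) (hconn : G.Connected) (hfin : G.LocallyFinite) (hG : G.IsUnimodular)
    (μ : Measure G.Aut) (hμ : μ.IsHaarMeasure)
    (S : Set V) (hS : G.IsOrbitSection S) (hc : G.stabWeight μ S < ∞) :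
    (∀ ν : Measure (Marks V D Ξ), IsProbabilityMeasure ν → G.IsAutInvariant ν →
      NetClass.IsUnimodular (G.randomRooting hconn hfin μ S ν)) ∧
    (∀ ρ : Measure (NetClass.{u} Ξ 1), NetClass.IsUnimodular ρ →
      (∀ᵐ g ∂ρ, NetClass.IsOn G g) →
      IsProbabilityMeasure (G.lift μ S ρ) ∧ G.IsAutInvariant (G.lift μ S ρ)) := by
  have := hG μ hμ
  refine ⟨fun ν _ hν => G.isUnimodular_randomRooting hconn hfin μ hS hc ν hν, fun ρ hρ hon => ?_⟩
  simp_rw [G.isOn_iff_mem_rootsRange hconn hfin] at hon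
  have := hρ.1
  exact ⟨G.isProbabilityMeasure_lift hconn hfin μ hS hon,
    G.isAutInvariant_lift hconn hfin μ hS hρ hon⟩
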